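/- Let $(\mathcal E,\otimes,I)$ be a monoidal category (associators and unitors are suppressed). A \emph{tangentoid} in $\mathcal E$ consists of an object $D$ and morphisms $p\colon D\to I$, $z\colon I\to D$, $s\colon D_2\to D$, $l\colon D\to D\otimes D$, $c\colon D\otimes D\to D\otimes D$, where for every $n$ the $n$-fold pullback $D_n$ of $p$ along itself (with projections $\pi_i\colon D_n\to D$) exists and is preserved by all iterates of the functor $D\otimes-$, such that: 1. $(p,z,s)$ is an additive bundle, i.e. $p\circ z=\mathrm{id}$, $p\circ s=p\circ\pi_1$, and $s$ is commutative, associative and has unit $z$ over $I$; 2. $(\mathrm{id}_D\otimes p)\circ l=z\circ p$, $\ l\circ z=(\mathrm{id}_D\otimes z)\circ z$, $\ (\mathrm{id}_D\otimes s)\circ\langle l\circ\pi_1,l\circ\pi_2\rangle=l\circ s$; 3. $(\mathrm{id}_D\otimes p)\circ c=p\otimes\mathrm{id}_D$, $\ c\circ(z\otimes\mathrm{id}_D)=\mathrm{id}_D\otimes z$, $\ (\mathrm{id}_D\otimes s)\circ\langle c\circ(\pi_1\otimes\mathrm{id}_D),c\circ(\pi_2\otimes\mathrm{id}_D)\rangle=c\circ(s\otimes\mathrm{id}_D)$;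 4. $(\mathrm{id}_D\otimes l)\circ l=(l\otimes\mathrm{id}_D)\circ l$, $\ c\circ c=\mathrm{id}$, $\ (\mathrm{id}_D\otimes c)(c\otimes\mathrm{id}_D)(\mathrm{id}_D\otimes c)=(c\otimes\mathrm{id}_D)(\mathrm{id}_D\otimes c)(c\otimes\mathrm{id}_D)$; 5. $c\circ l=l$, $\ (c\otimes\mathrm{id}_D)\circ(\mathrm{id}_D\otimes c)\circ(l\otimes\mathrm{id}_D)=(\mathrm{id}_D\otimes l)\circ c$; 6. the square with sides $(\mathrm{id}_D\otimes s)\circ\langle l\circ\pi_1,(z\otimes\mathrm{id}_D)\circ\pi_2\rangle\colon D_2\to D\otimes D$, $\ p\circ\pi_1\colon D_2\to I$, $\ \mathrm{id}_D\otimes p\colon D\otimes D\to D$ and $z\colon I\to D$ is a pullback. A morphism of tangentoids is a morphism $f\colon D\to D'$ of $\mathcal E$ compatible with $p,z,s,l,c$. A tangentoid is \emph{coexponentiable} if for every $n$ the functor $D_n\otimes-\colon\mathcal E\to\mathcal E$ has a left adjoint. \textbf{Theorem.} Let $R$ be a principal ideal domain, and let $\mathrm{cAlg}_R$ be the category of commutative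 unital $R$-algebras with monoidal product $\otimes_R$ and unit $R$. Up to isomorphism of tangentoids, there are exactly two coexponentiable tangentoids in $\mathrm{cAlg}_R$: (a) $R$ itself, with the trivial structure (all structure morphisms are identities, up to the canonical identifications); (b) the ring of dual numbers $R[\epsilon]=R[x]/(x^2)$, where $p(\epsilon)=0$, $z$ is the canonical inclusion, $s$ sends $\epsilon_1$ and $\epsilon_2$ to $\epsilon$ (with $D_2=R[\epsilon_1,\epsilon_2]=R[x_1,x_2]/(x_1^2,x_1x_2,x_2^2)$), $l(\epsilon)=\epsilon\otimes\epsilon$, and $c$ is the symmetry of $\otimes_R$. That is: (a) and (b) are coexponentiable tangentoids, $R$ and $R[\epsilon]$ are not isomorphic as $R$-algebras, and every coexponentiable tangentoid in $\mathrm{cAlg}_R$ is isomorphic, as a tangentoid, to (a) or to (b). -/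

import Mathlib

open CategoryTheory MonoidalCategory Limits
open scoped TensorProduct DualNumber

universe v u

noncomputable section

namespace TangentoidTheory

section FiberPowers

variable {C : Type u} [Category.{v} C] {E B : C}

/-- All `n`-fold pullbacks of `q` along itself exist. -/
class HasFiberPowers (q : E ⟶ B) : Prop where
  hasWidePullback : ∀ n : ℕ, HasWidePullback B (fun _ : Fin n => E) (fun _ => q)

attribute [instance] HasFiberPowers.hasWidePullback

/-- The diagram `E ⟶ B ⟵ E ...` with `n` legs, all equal to `q`. -/
abbrev legs (q : E ⟶ B) (n : ℕ) : WidePullbackShape (Fin n) ⥤ C :=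
  WidePullbackShape.wideCospan B (fun _ : Fin n => E) (fun _ => q)

/-- The `n`-fold pullback `E_n` of `q` along itself. -/
abbrev fiberPower (q : E ⟶ B) [HasFiberPowers q] (n : ℕ) : C :=
  widePullback B (fun _ : Fin n => E) (fun _ => q)

/-- The projections `E_n ⟶ E`, numbered from `0`. -/
abbrev proj (q : E ⟶ B) [HasFiberPowers q] {n : ℕ} (i : Fin n) : fiberPower q n ⟶ E :=
  WidePullback.π (fun _ : Fin n => q) i

theorem proj_comp (q : E ⟶ B) [HasFiberPowers q] {n : ℕ} (i j : Fin n) :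
    proj q i ≫ q = proj q j ≫ q :=
  (WidePullback.π_arrow (fun _ : Fin n => q) i).trans
    (WidePullback.π_arrow (fun _ : Fin n => q) j).symm

theorem proj_comp_assoc (q : E ⟶ B) [HasFiberPowers q] {n : ℕ} (i j : Fin n) {X : C} (h : B ⟶ X) :
    proj q i ≫ q ≫ h = proj q j ≫ q ≫ h := by
  rw [← Category.assoc, proj_comp q i j, Category.assoc]

/-- The morphism `⟨f, g⟩ : X ⟶ E_2` induced by `f` and `g` with the same composite to `B`. -/
def pair (q : E ⟶ B) [HasFiberPowers q] {X : C} (f g : X ⟶ E) (w : f ≫ q = g ≫ q) :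
    X ⟶ fiberPower q 2 :=
  WidePullback.lift (f ≫ q) ![f, g] (by
    intro j
    fin_cases j
    · rfl
    · exact w.symm)

theorem pair_proj_zero (q : E ⟶ B) [HasFiberPowers q] {X : C} (f g : X ⟶ E)
    (w : f ≫ q = g ≫ q) : pair q f g w ≫ proj q 0 = f :=
  WidePullback.lift_π (arrows := fun _ : Fin 2 => q) _ _ _ 0

theorem pair_proj_one (q : E ⟶ B) [HasFiberPowers q] {X : C} (f g : X ⟶ E)
    (w : f ≫ q = g ≫ q) : pair q f g w ≫ proj q 1 = g :=
  WidePullback.lift_π (arrows := fun _ : Fin 2 => q) _ _ _ 1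

theorem fiberPower_two_hom_ext (q : E ⟶ B) [HasFiberPowers q] {X : C}
    {f g : X ⟶ fiberPower q 2} (h₀ : f ≫ proj q 0 = g ≫ proj q 0)
    (h₁ : f ≫ proj q 1 = g ≫ proj q 1) : f = g := by
  apply WidePullback.hom_ext
  · intro j
    fin_cases j
    · exact h₀
    · exact h₁
  · have hb := WidePullback.π_arrow (fun _ : Fin 2 => q) 0
    rw [← hb, ← Category.assoc, ← Category.assoc]
    exact congrArg (· ≫ q) h₀

/-- An additive bundle: a commutative monoid `(p, z, s)` in the slice category over `B`, all of
whose fibre powers exist. -/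
structure AdditiveBundle (E B : C) where
  /-- the projection -/
  p : E ⟶ B
  [fiberPowers : HasFiberPowers p]
  /-- the zero morphism -/
  z : B ⟶ E
  /-- the sum morphism -/
  s : fiberPower p 2 ⟶ E
  z_p : z ≫ p = 𝟙 B
  s_p : s ≫ p = proj p 0 ≫ p
  s_comm : pair p (proj p 1) (proj p 0) (proj_comp p 1 0) ≫ s = s
  s_assoc :
    pair p (pair p (proj p (0 : Fin 3)) (proj p 1) (proj_comp p 0 1) ≫ s) (proj p 2)
        (by rw [Category.assoc, s_p, ← Category.assoc, pair_proj_zero, proj_comp p 0 2]) ≫ s =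
      pair p (proj p (0 : Fin 3)) (pair p (proj p 1) (proj p 2) (proj_comp p 1 2) ≫ s)
        (by rw [Category.assoc, s_p, ← Category.assoc (pair _ _ _ _), pair_proj_zero,
              proj_comp p 0 1]) ≫ s
  zero_s : pair p (p ≫ z) (𝟙 E) (by rw [Category.assoc, z_p, Category.comp_id, Category.id_comp])
    ≫ s = 𝟙 E

attribute [instance] AdditiveBundle.fiberPowers

end FiberPowers

section Tangentoids

variable {C : Type u} [Category.{v} C] [MonoidalCategory C]

/-- The `k`-th iterate of the functor `D ⊗ -`. -/
def tensorPow (D : C) : ℕ → (C ⥤ C)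
  | 0 => 𝟭 C
  | k + 1 => tensorPow D k ⋙ tensorLeft D

/-- All `n`-fold pullbacks of `q` along itself are preserved by all iterates of `D ⊗ -`. -/
class TensorPreservesFiberPowers (D : C) {E B : C} (q : E ⟶ B) : Prop where
  preserves : ∀ k n : ℕ, PreservesLimit (legs q n) (tensorPow D k)

instance (D : C) {E B : C} (q : E ⟶ B) [h : TensorPreservesFiberPowers D q] (n : ℕ) :
    PreservesLimit (legs q n) (tensorLeft D) :=
  haveI : PreservesLimit (legs q n) (tensorPow D 1) := h.preserves 1 n
  preservesLimit_of_natIso (F := tensorPow D 1) (legs q n) (Functor.leftUnitor (tensorLeft D))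

/-- The morphism `⟨f, g⟩ : X ⟶ D ⊗ E_2` induced by `f, g : X ⟶ D ⊗ E` with the same composite to
`D ⊗ B`, where `D ⊗ E_2` is the pullback of `D ⊗ q` along itself. -/
def tensorPair (D : C) {E B : C} (q : E ⟶ B) [HasFiberPowers q] [TensorPreservesFiberPowers D q]
    {X : C} (f g : X ⟶ D ⊗ E) (w : f ≫ D ◁ q = g ≫ D ◁ q) : X ⟶ D ⊗ fiberPower q 2 :=
  (isLimitOfPreserves (tensorLeft D) (limit.isLimit (legs q 2))).lift
    (WidePullbackShape.mkCone (F := legs q 2 ⋙ tensorLeft D) (f ≫ D ◁ q)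
      (fun j => (![f, g] j : X ⟶ D ⊗ E)) (by
        intro j
        fin_cases j
        · rfl
        · exact w.symm))

theorem tensorPair_proj_zero (D : C) {E B : C} (q : E ⟶ B) [HasFiberPowers q]
    [TensorPreservesFiberPowers D q] {X : C} (f g : X ⟶ D ⊗ E) (w : f ≫ D ◁ q = g ≫ D ◁ q) :
    tensorPair D q f g w ≫ D ◁ proj q 0 = f :=
  (isLimitOfPreserves (tensorLeft D) (limit.isLimit (legs q 2))).fac _ (some 0)

theorem tensorPair_proj_one (D : C) {E B : C} (q : E ⟶ B) [HasFiberPowers q]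
    [TensorPreservesFiberPowers D q] {X : C} (f g : X ⟶ D ⊗ E) (w : f ≫ D ◁ q = g ≫ D ◁ q) :
    tensorPair D q f g w ≫ D ◁ proj q 1 = g :=
  (isLimitOfPreserves (tensorLeft D) (limit.isLimit (legs q 2))).fac _ (some 1)

/-- A tangentoid structure on the object `D` of a monoidal category. -/
structure TangentoidStr (D : C) extends AdditiveBundle D (𝟙_ C) where
  [tensorPreserves : TensorPreservesFiberPowers D p]
  /-- the vertical lift -/
  l : D ⟶ D ⊗ D
  /-- the canonical flip -/
  c : D ⊗ D ⟶ D ⊗ D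
  -- `(z, l)` is a morphism of additive bundles from `D` to `D ⊗ D` over `D`
  l_p : l ≫ D ◁ p = p ≫ z ≫ (ρ_ D).inv
  z_l : z ≫ l = z ≫ (ρ_ D).inv ≫ D ◁ z
  s_l :
    tensorPair D p (proj p 0 ≫ l) (proj p 1 ≫ l)
        (by rw [Category.assoc, Category.assoc, l_p, proj_comp_assoc p 0 1]) ≫ D ◁ s =
      s ≫ l
  -- `(𝟙, c)` is a morphism of additive bundles from `(p, z, s) ⊗ D` to `D ⊗ (p, z, s)`
  c_p : c ≫ D ◁ p = p ▷ D ≫ (λ_ D).hom ≫ (ρ_ D).inv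
  z_c : z ▷ D ≫ c = (λ_ D).hom ≫ (ρ_ D).inv ≫ D ◁ z
  s_c :
    tensorPair D p (proj p 0 ▷ D ≫ c) (proj p 1 ▷ D ≫ c)
        (by rw [Category.assoc, Category.assoc, c_p, ← comp_whiskerRight_assoc,
              ← comp_whiskerRight_assoc, proj_comp p 0 1]) ≫ D ◁ s =
      s ▷ D ≫ c
  -- coassociativity of `l`, and the symmetry and braid relations for `c`
  l_l : l ≫ D ◁ l = l ≫ l ▷ D ≫ (α_ D D D).hom
  c_c : c ≫ c = 𝟙 (D ⊗ D)
  braid :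
    D ◁ c ≫ ((α_ D D D).inv ≫ c ▷ D ≫ (α_ D D D).hom) ≫ D ◁ c =
      ((α_ D D D).inv ≫ c ▷ D ≫ (α_ D D D).hom) ≫ D ◁ c ≫
        ((α_ D D D).inv ≫ c ▷ D ≫ (α_ D D D).hom)
  -- compatibility of `l` and `c`
  l_c : l ≫ c = l
  l_c_c :
    l ▷ D ≫ (α_ D D D).hom ≫ D ◁ c ≫ ((α_ D D D).inv ≫ c ▷ D ≫ (α_ D D D).hom) = c ≫ D ◁ l
  -- universality of the vertical lift
  lift_universal :
    IsPullback
      (tensorPair D p (proj p (0 : Fin 2) ≫ l) (proj p 1 ≫ (λ_ D).inv ≫ z ▷ D)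
          (by
            rw [Category.assoc, Category.assoc, Category.assoc, l_p, ← whisker_exchange,
              ← leftUnitor_inv_naturality_assoc, proj_comp_assoc p (0 : Fin 2) 1, unitors_inv_equal,
              ← rightUnitor_inv_naturality]) ≫ D ◁ s)
      (proj p 0 ≫ p) (D ◁ p) (z ≫ (ρ_ D).inv)

attribute [instance] TangentoidStr.tensorPreserves

variable (C) in
/-- A tangentoid in a monoidal category. -/
structure Tangentoid where
  /-- the underlying object -/
  obj : C
  /-- the tangentoid structure -/
  str : TangentoidStr obj

namespace Tangentoid

/-- Coexponentiability: each functor `D_n ⊗ -` has a left adjoint. -/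
def IsCoexponentiable (T : Tangentoid C) : Prop :=
  ∀ n : ℕ, (tensorLeft (fiberPower T.str.p n)).IsRightAdjoint

/-- A morphism of tangentoids. -/
@[ext]
structure Hom (T T' : Tangentoid C) where
  /-- the underlying morphism -/
  hom : T.obj ⟶ T'.obj
  hom_p : hom ≫ T'.str.p = T.str.p
  z_hom : T.str.z ≫ hom = T'.str.z
  hom_s :
    pair T'.str.p (proj T.str.p 0 ≫ hom) (proj T.str.p 1 ≫ hom)
        (by rw [Category.assoc, Category.assoc, hom_p, proj_comp T.str.p 0 1]) ≫ T'.str.s =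
      T.str.s ≫ hom
  hom_l : hom ≫ T'.str.l = T.str.l ≫ (hom ⊗ₘ hom)
  hom_c : (hom ⊗ₘ hom) ≫ T'.str.c = T.str.c ≫ (hom ⊗ₘ hom)

instance : Category (Tangentoid C) where
  Hom := Hom
  id T :=
    { hom := 𝟙 T.obj
      hom_p := Category.id_comp _
      z_hom := Category.comp_id _
      hom_s := by
        refine (congrArg (· ≫ T.str.s) ?_).trans
          ((Category.id_comp _).trans (Category.comp_id _).symm)
        apply fiberPower_two_hom_ext
        · rw [pair_proj_zero, Category.comp_id, Category.id_comp]
        · rw [pair_proj_one, Category.comp_id, Category.id_comp]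
      hom_l := by simp
      hom_c := by simp }
  comp {T T' T''} f g :=
    { hom := f.hom ≫ g.hom
      hom_p := by rw [Category.assoc, g.hom_p, f.hom_p]
      z_hom := by rw [← Category.assoc, f.z_hom, g.z_hom]
      hom_s := by
        have h : T.str.s ≫ f.hom ≫ g.hom =
            (pair T'.str.p (proj T.str.p 0 ≫ f.hom) (proj T.str.p 1 ≫ f.hom)
                (by rw [Category.assoc, Category.assoc, f.hom_p, proj_comp T.str.p 0 1]) ≫
              pair T''.str.p (proj T'.str.p 0 ≫ g.hom) (proj T'.str.p 1 ≫ g.hom)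
                (by rw [Category.assoc, Category.assoc, g.hom_p, proj_comp T'.str.p 0 1])) ≫
            T''.str.s := by
          rw [← Category.assoc, ← f.hom_s, Category.assoc, ← g.hom_s]
          exact (Category.assoc _ _ _).symm
        rw [h]
        refine congrArg (· ≫ T''.str.s) ?_
        apply fiberPower_two_hom_ext
        · rw [pair_proj_zero, Category.assoc, pair_proj_zero,
            ← Category.assoc (pair _ _ _ _) (proj T'.str.p 0), pair_proj_zero, Category.assoc]
        · rw [pair_proj_one, Category.assoc, pair_proj_one,
            ← Category.assoc (pair _ _ _ _) (proj T'.str.p 1), pair_proj_one, Category.assoc]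
      hom_l := by
        rw [Category.assoc, g.hom_l, ← Category.assoc, f.hom_l, Category.assoc,
          tensorHom_comp_tensorHom]
      hom_c := by
        rw [← tensorHom_comp_tensorHom, Category.assoc, g.hom_c, ← Category.assoc, f.hom_c,
          Category.assoc] }
  id_comp f := Hom.ext (Category.id_comp _)
  comp_id f := Hom.ext (Category.comp_id _)
  assoc f g h := Hom.ext (Category.assoc _ _ _)

end Tangentoid

end Tangentoids

section Algebras

variable {R : Type u} [CommRing R]

/-- The trivial tangentoid structure on the unit object `R`: all structure maps are identities, up
to the identifications `R ⊗ R = R` and `R ×_R R = R`. -/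
structure IsTrivialStr (t : TangentoidStr (𝟙_ (CommAlgCat.{u} R))) : Prop where
  p_eq : t.p = 𝟙 _
  z_eq : t.z = 𝟙 _
  s_eq : t.s = proj t.p 0
  l_eq : t.l = (λ_ _).inv
  c_eq : t.c = 𝟙 _

/-- The standard tangentoid structure on the dual numbers: `p ε = 0`, `z` is the inclusion of the
scalars, `s` adds the `ε`-coordinates, `l ε = ε ⊗ ε`, and `c` is the symmetry. -/
structure IsDualNumberStr (t : TangentoidStr (CommAlgCat.of R R[ε])) : Prop where
  p_eq : t.p = CommAlgCat.ofHom (TrivSqZeroExt.fstHom R R R)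
  z_eq : t.z = CommAlgCat.ofHom (Algebra.ofId R R[ε])
  s_fst : ∀ x : (fiberPower t.p 2 : CommAlgCat.{u} R),
    TrivSqZeroExt.fst (t.s.hom x : R[ε]) = TrivSqZeroExt.fst ((proj t.p 0).hom x : R[ε])
  s_snd : ∀ x : (fiberPower t.p 2 : CommAlgCat.{u} R),
    TrivSqZeroExt.snd (t.s.hom x : R[ε]) =
      TrivSqZeroExt.snd ((proj t.p 0).hom x : R[ε]) + TrivSqZeroExt.snd ((proj t.p 1).hom x : R[ε])
  l_eps : t.l.hom (ε : R[ε]) = (ε : R[ε]) ⊗ₜ[R] (ε : R[ε])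
  c_eq : t.c = (β_ _ _).hom

end Algebras

end TangentoidTheory

end

/-! Let `A` be the kernel of the augmentation `p`, so that `D = R ⊕ A`. The unit laws of the
additive bundle force `s` to be `(x, y) ↦ x + y - p x` (`AdditiveBundle.isSum`). Since this map is
multiplicative and `(a, 0) * (0, b) = 0` in `D_2`, the ideal `A` has square zero
(`AdditiveBundle.mul_eq_zero`). The flip is forced to be the symmetry
(`TangentoidStr.flip_eq_braiding`).

Coexponentiability makes `D ⊗ -` preserve limits. Preserving infinite powers of `R` makes `D`
finitely generated, and preserving monomorphisms makes it torsion-free, so over a principal ideal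
domain it is free. Conversely, Weil restriction gives a left adjoint of `D ⊗ -` for `D` finite and
free.

Universality of the lift says that `(a, b) ↦ l a + 1 ⊗ b` is a bijection from `A × A` onto the
kernel of `id ⊗ p`. If `A` has rank `n`, comparing ranks gives `2n + (n + 1) = (n + 1)²`, so `n` is
`0` or `1` (`TangentoidStr.finrank_ker_eq`). For `n = 0` the augmentation is an isomorphism onto
`R`. For `n = 1` and `A = R e`, the axioms on `l` leave `l e = d • (e ⊗ e)`, universality makes `d`
a unit, and `d • e` is the required `ε` (`TangentoidStr.exists_lift_eq_tmul`). -/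

noncomputable section

/-! ### Monomorphisms and pullbacks of algebras on elements -/

namespace CommAlgCat

open Polynomial in
/-- The forgetful functor of commutative algebras is corepresented by the polynomial ring. -/
def forgetCorepresentableBy (R : Type u) [CommRing R] :
    (forget (CommAlgCat.{u} R)).CorepresentableBy (CommAlgCat.of R R[X]) where
  homEquiv {A} :=
    { toFun := fun f => f.hom (X : R[X])
      invFun := fun a => CommAlgCat.ofHom (aeval (R := R) (A := A) a)
      left_inv := fun f => by
        apply CommAlgCat.hom_ext
        apply Polynomial.algHom_ext
        exact aeval_X _
      right_inv := fun a => aeval_X _ }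
  homEquiv_comp _ _ := rfl

instance (R : Type u) [CommRing R] : (forget (CommAlgCat.{u} R)).IsCorepresentable :=
  (forgetCorepresentableBy R).isCorepresentable

variable {R : Type u} [CommRing R]

theorem injective_of_mono {A B : CommAlgCat.{u} R} (f : A ⟶ B) [Mono f] :
    Function.Injective f.hom :=
  ConcreteCategory.injective_of_mono_of_preservesPullback f

theorem mono_of_injective {A B : CommAlgCat.{u} R} (f : A ⟶ B) (hf : Function.Injective f.hom) :
    Mono f :=
  ConcreteCategory.mono_of_injective f hf

/-- A commutative square of algebras is a pullback if it is one on underlying sets. -/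
theorem isPullback_of_elements {W X Y Z : CommAlgCat.{u} R} {f : W ⟶ X} {g : W ⟶ Y} {h : X ⟶ Z}
    {i : Y ⟶ Z} (w : f ≫ h = g ≫ i)
    (inj : ∀ a b, f.hom a = f.hom b → g.hom a = g.hom b → a = b)
    (surj : ∀ x y, h.hom x = i.hom y → ∃ a, f.hom a = x ∧ g.hom a = y) : IsPullback f g h i := by
  apply IsPullback.of_map (forget (CommAlgCat.{u} R)) w
  rw [Types.isPullback_iff]
  refine ⟨?_, fun a b hab => inj a b hab.1 hab.2, fun x y hxy => surj x y hxy⟩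
  rw [← Functor.map_comp, ← Functor.map_comp, w]

theorem exists_of_isPullback {W X Y Z : CommAlgCat.{u} R} {f : W ⟶ X} {g : W ⟶ Y} {h : X ⟶ Z}
    {i : Y ⟶ Z} (sq : IsPullback f g h i) (x : X) (y : Y) (hxy : h.hom x = i.hom y) :
    ∃ a, f.hom a = x ∧ g.hom a = y :=
  Types.exists_of_isPullback (sq.map (forget (CommAlgCat.{u} R))) x y hxy

theorem ext_of_isPullback {W X Y Z : CommAlgCat.{u} R} {f : W ⟶ X} {g : W ⟶ Y} {h : X ⟶ Z}
    {i : Y ⟶ Z} (sq : IsPullback f g h i) {a b : W} (hf : f.hom a = f.hom b)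
    (hg : g.hom a = g.hom b) : a = b :=
  Types.ext_of_isPullback (sq.map (forget (CommAlgCat.{u} R))) hf hg

end CommAlgCat

/-! ### Fibre powers on elements -/

namespace TangentoidTheory

variable {R : Type u} [CommRing R]

instance {E B : CommAlgCat.{u} R} (q : E ⟶ B) : HasFiberPowers q where
  hasWidePullback n := by
    have : HasFiniteLimits (CommAlgCat.{u} R) := inferInstance
    unfold HasWidePullback
    infer_instance

section Elements

variable {E B : CommAlgCat.{u} R} {q : E ⟶ B} [HasFiberPowers q]

/-- An element is a homomorphism out of `R[X]`, so this is the uniqueness part of the universal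
property. The base component matters for `n = 0`, where there are no projections. -/
theorem fiberPower_ext {n : ℕ} {x y : (fiberPower q n : CommAlgCat.{u} R)}
    (hb : (WidePullback.base fun _ : Fin n => q).hom x =
      (WidePullback.base fun _ : Fin n => q).hom y)
    (h : ∀ i, (proj q i).hom x = (proj q i).hom y) : x = y := by
  have hxy : CommAlgCat.ofHom (Polynomial.aeval (R := R) x) =
      CommAlgCat.ofHom (Polynomial.aeval (R := R) y) := by
    refine WidePullback.hom_ext (fun _ : Fin n => q) _ _ (fun i => ?_) ?_
    · apply CommAlgCat.hom_ext
      apply Polynomial.algHom_ext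
      simpa using h i
    · apply CommAlgCat.hom_ext
      apply Polynomial.algHom_ext
      simpa using hb
  simpa using DFunLike.congr_fun (congrArg CommAlgCat.Hom.hom hxy) Polynomial.X

theorem fiberPower_two_ext {x y : (fiberPower q 2 : CommAlgCat.{u} R)}
    (h₀ : (proj q 0).hom x = (proj q 0).hom y) (h₁ : (proj q 1).hom x = (proj q 1).hom y) :
    x = y := by
  refine fiberPower_ext ?_ (fun i => ?_)
  · have hb := WidePullback.π_arrow (fun _ : Fin 2 => q) 0
    rw [← hb]
    exact congrArg q.hom h₀
  · fin_cases i
    · exact h₀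
    · exact h₁

theorem proj_zero_pair_apply {X : CommAlgCat.{u} R} (f g : X ⟶ E) (w : f ≫ q = g ≫ q) (x : X) :
    (proj q 0).hom ((pair q f g w).hom x) = f.hom x :=
  DFunLike.congr_fun (congrArg CommAlgCat.Hom.hom (pair_proj_zero q f g w)) x

theorem proj_one_pair_apply {X : CommAlgCat.{u} R} (f g : X ⟶ E) (w : f ≫ q = g ≫ q) (x : X) :
    (proj q 1).hom ((pair q f g w).hom x) = g.hom x :=
  DFunLike.congr_fun (congrArg CommAlgCat.Hom.hom (pair_proj_one q f g w)) x

theorem comp_proj_one_apply (x : (fiberPower q 2 : CommAlgCat.{u} R)) :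
    q.hom ((proj q 1).hom x) = q.hom ((proj q 0).hom x) :=
  DFunLike.congr_fun (congrArg CommAlgCat.Hom.hom (proj_comp q 1 0)) x

/-- The base and the projections embed `E_n` in `B × Eⁿ`, a finite module over a Noetherian ring. -/
theorem finite_fiberPower [IsNoetherianRing R] [Module.Finite R E] [Module.Finite R B] (n : ℕ) :
    Module.Finite R (fiberPower q n : CommAlgCat.{u} R) :=
  Module.Finite.of_injective
    (((WidePullback.base fun _ : Fin n => q).hom.toLinearMap).prod
      (LinearMap.pi fun i : Fin n => (proj q i).hom.toLinearMap))
    fun _ _ h => fiberPower_ext (congrArg Prod.fst h)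
      fun i => congrFun (congrArg Prod.snd h) i

theorem isTorsionFree_fiberPower [Module.IsTorsionFree R E] [Module.IsTorsionFree R B] (n : ℕ) :
    Module.IsTorsionFree R (fiberPower q n : CommAlgCat.{u} R) :=
  Function.Injective.moduleIsTorsionFree
    (((WidePullback.base fun _ : Fin n => q).hom.toLinearMap).prod
      (LinearMap.pi fun i : Fin n => (proj q i).hom.toLinearMap))
    (fun _ _ h => fiberPower_ext (congrArg Prod.fst h) fun i => congrFun (congrArg Prod.snd h) i)
    (fun r x => map_smul _ r x)

end Elements

end TangentoidTheory

end
noncomputable section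

/-! ### Weil restriction along a finite free algebra -/

namespace WeilRestriction

variable {R : Type u} [CommRing R] {D : Type u} [CommRing D] [Algebra R D] {ι : Type u}
  (b : Module.Basis ι R D)

/-- The `i`-th coordinate of an element of `D ⊗ B` with respect to a basis of `D`. -/
def coord (B : Type u) [CommRing B] [Algebra R B] (i : ι) : D ⊗[R] B →ₗ[R] B :=
  (TensorProduct.lid R B).toLinearMap ∘ₗ TensorProduct.map (b.coord i) LinearMap.id

theorem coord_tmul {B : Type u} [CommRing B] [Algebra R B] (i : ι) (d : D) (x : B) :
    coord b B i (d ⊗ₜ x) = b.coord i d • x := by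
  simp [coord]

theorem coord_map {B B' : Type u} [CommRing B] [Algebra R B] [CommRing B'] [Algebra R B']
    (g : B →ₐ[R] B') (i : ι) (w : D ⊗[R] B) :
    coord b B' i (Algebra.TensorProduct.map (AlgHom.id R D) g w) = g (coord b B i w) := by
  induction w with
  | zero => simp
  | add x y hx hy => simp only [map_add, hx, hy]
  | tmul d x => simp only [Algebra.TensorProduct.map_tmul, coord_tmul, map_smul]; rfl

variable [Fintype ι]

theorem sum_coord {B : Type u} [CommRing B] [Algebra R B] (w : D ⊗[R] B) :
    ∑ i, b i ⊗ₜ[R] coord b B i w = w := by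
  induction w with
  | zero => simp
  | add x y hx hy => simp only [map_add, TensorProduct.tmul_add, Finset.sum_add_distrib, hx, hy]
  | tmul d x =>
    simp only [coord_tmul, ← TensorProduct.smul_tmul, ← TensorProduct.sum_tmul,
      Module.Basis.coord_apply, b.sum_repr]

theorem coord_ext {B : Type u} [CommRing B] [Algebra R B] {w w' : D ⊗[R] B}
    (h : ∀ i, coord b B i w = coord b B i w') : w = w' := by
  rw [← sum_coord b w, ← sum_coord b w']
  simp only [h]

theorem coord_sum_tmul {B : Type u} [CommRing B] [Algebra R B] (x : ι → B) (i : ι) :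
    coord b B i (∑ j, b j ⊗ₜ[R] x j) = x i := by
  classical
  rw [map_sum, Finset.sum_eq_single i]
  · simp [coord_tmul]
  · intro j _ hj
    simp [coord_tmul, hj]
  · simp

variable (A : Type u) [CommRing A] [Algebra R A]

/-- The universal function from `A` to an algebra of the form `D ⊗ P`. -/
def universal (a : A) : D ⊗[R] MvPolynomial (A × ι) R :=
  ∑ i, b i ⊗ₜ[R] MvPolynomial.X (a, i)

/-- The elements that have to vanish for the universal function to be an algebra homomorphism. -/
inductive Relation : D ⊗[R] MvPolynomial (A × ι) R → Prop
  | add (x y : A) : Relation (universal b A (x + y) - (universal b A x + universal b A y))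
  | mul (x y : A) : Relation (universal b A (x * y) - universal b A x * universal b A y)
  | algebraMap (r : R) : Relation (universal b A (algebraMap R A r) - algebraMap R _ r)

/-- The ideal generated by the coordinates of the relations. -/
def ideal : Ideal (MvPolynomial (A × ι) R) :=
  Ideal.span {f | ∃ w i, Relation b A w ∧ f = coord b _ i w}

/-- The Weil restriction of `A` along `R → D`. -/
abbrev Obj : Type u := MvPolynomial (A × ι) R ⧸ ideal b A

/-- The quotient map from the polynomial ring to the Weil restriction. -/
abbrev quot : MvPolynomial (A × ι) R →ₐ[R] Obj b A := Ideal.Quotient.mkₐ R (ideal b A)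

theorem map_quot_of_relation {w : D ⊗[R] MvPolynomial (A × ι) R} (hw : Relation b A w) :
    Algebra.TensorProduct.map (AlgHom.id R D) (quot b A) w = 0 := by
  apply coord_ext b
  intro i
  rw [coord_map, map_zero]
  exact Ideal.Quotient.eq_zero_iff_mem.mpr (Ideal.subset_span ⟨w, i, hw, rfl⟩)

/-- The unit `A → D ⊗ Obj A` of the Weil restriction. -/
def unit : A →ₐ[R] D ⊗[R] Obj b A :=
  let m := Algebra.TensorProduct.map (AlgHom.id R D) (quot b A)
  have hC : ∀ r, m (universal b A (algebraMap R A r)) = algebraMap R _ r := fun r => by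
    have := map_quot_of_relation b A (.algebraMap r)
    rwa [map_sub, sub_eq_zero, AlgHom.commutes] at this
  have hA : ∀ x y, m (universal b A (x + y)) = m (universal b A x) + m (universal b A y) :=
    fun x y => by
      have := map_quot_of_relation b A (.add x y)
      rwa [map_sub, sub_eq_zero, map_add] at this
  { toFun := fun a => m (universal b A a)
    -- `0` and `1` are images of scalars, so the `algebraMap` relations cover them.
    map_one' := by rw [← map_one (algebraMap R A), hC, map_one]
    map_zero' := by rw [← map_zero (algebraMap R A), hC, map_zero]
    map_mul' := fun x y => by
      have := map_quot_of_relation b A (.mul x y)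
      rwa [map_sub, sub_eq_zero, map_mul] at this
    map_add' := hA
    commutes' := hC }

theorem unit_apply (a : A) : unit b A a =
    Algebra.TensorProduct.map (AlgHom.id R D) (quot b A) (universal b A a) := rfl

theorem coord_unit (a : A) (i : ι) : coord b _ i (unit b A a) =
    quot b A (MvPolynomial.X (a, i)) := by
  rw [unit_apply, coord_map, universal, coord_sum_tmul]

variable {A} {B : Type u} [CommRing B] [Algebra R B] (f : A →ₐ[R] D ⊗[R] B)

/-- Substituting the coordinates of `f` for the variables specialises the universal function to `f`.
As `f` is a homomorphism, this substitution kills all the relations, as `desc` requires. -/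
theorem map_aeval_universal (a : A) :
    Algebra.TensorProduct.map (AlgHom.id R D)
      (MvPolynomial.aeval fun x : A × ι => coord b B x.2 (f x.1)) (universal b A a) = f a := by
  apply coord_ext b
  intro i
  rw [coord_map, universal, coord_sum_tmul, MvPolynomial.aeval_X]

/-- The homomorphism from the Weil restriction induced by `A → D ⊗ B`. -/
def desc : Obj b A →ₐ[R] B :=
  Ideal.Quotient.liftₐ (ideal b A)
    (MvPolynomial.aeval fun x : A × ι => coord b B x.2 (f x.1)) (by
      intro p hp
      refine (Ideal.span_le (I := RingHom.ker
        (MvPolynomial.aeval fun x : A × ι => coord b B x.2 (f x.1)))).mpr ?_ hp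
      rintro _ ⟨w, i, hw, rfl⟩
      rw [SetLike.mem_coe, RingHom.mem_ker, ← coord_map]
      cases hw <;> simp [map_aeval_universal])

theorem map_desc_unit (a : A) :
    Algebra.TensorProduct.map (AlgHom.id R D) (desc b f) (unit b A a) = f a := by
  apply coord_ext b
  intro i
  rw [coord_map, coord_unit]
  exact MvPolynomial.aeval_X _ _

/-- The coordinates of `unit` are the generators of `Obj`, so `g` is determined on generators by the
coordinates of `f`. -/
theorem eq_desc (g : Obj b A →ₐ[R] B)
    (hg : ∀ a, Algebra.TensorProduct.map (AlgHom.id R D) g (unit b A a) = f a) :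
    g = desc b f := by
  apply Ideal.Quotient.algHom_ext
  apply MvPolynomial.algHom_ext
  rintro ⟨a, i⟩
  have h := congrArg (coord b B i) (hg a)
  have h' := congrArg (coord b B i) (map_desc_unit b f a)
  rw [coord_map, coord_unit] at h h'
  exact h.trans h'.symm

end WeilRestriction

namespace CommAlgCat

variable {R : Type u} [CommRing R]

/-- The unit of the Weil restriction of `A` is initial among the morphisms from `A` to algebras of
the form `D ⊗ B`. -/
theorem isRightAdjoint_tensorLeft (D : CommAlgCat.{u} R) [Module.Finite R D] [Module.Free R D] :
    (tensorLeft D).IsRightAdjoint := by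
  have b := Module.Free.chooseBasis R D
  have : ∀ A : CommAlgCat.{u} R, HasInitial (StructuredArrow A (tensorLeft D)) := fun A =>
    (IsInitial.ofUniqueHom (X := StructuredArrow.mk (T := tensorLeft D)
        (Y := CommAlgCat.of R (WeilRestriction.Obj b A))
        (CommAlgCat.ofHom (WeilRestriction.unit b A)))
      (fun Y => StructuredArrow.homMk (CommAlgCat.ofHom (WeilRestriction.desc b Y.hom.hom)) (by
        apply CommAlgCat.hom_ext
        exact AlgHom.ext fun a => WeilRestriction.map_desc_unit b Y.hom.hom a))
      (fun Y g => by
        apply StructuredArrow.hom_ext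
        apply CommAlgCat.hom_ext
        exact WeilRestriction.eq_desc b Y.hom.hom g.right.hom fun a =>
          DFunLike.congr_fun (congrArg CommAlgCat.Hom.hom (StructuredArrow.w g)) a)).hasInitial
  exact isRightAdjointOfStructuredArrowInitials _

/-! ### Finiteness and torsion-freeness from a left adjoint of `D ⊗ -` -/

section

variable (D : CommAlgCat.{u} R) [(tensorLeft D).IsRightAdjoint]

/-- The product of copies of `R` indexed by `S`. -/
def powerFan (S : Type u) : Fan fun _ : S => CommAlgCat.of R R :=
  Fan.mk (CommAlgCat.of R (S → R)) fun i => CommAlgCat.ofHom (Pi.evalAlgHom R (fun _ => R) i)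

/-- `powerFan` is a product. -/
def powerFanIsLimit (S : Type u) : IsLimit (powerFan (R := R) S) :=
  Fan.IsLimit.mk _ (fun s => CommAlgCat.ofHom (AlgHom.pi fun i => (s.proj i).hom))
    (fun _ _ => rfl) (fun s m hm => by
      apply CommAlgCat.hom_ext
      apply AlgHom.ext
      intro x
      funext i
      exact DFunLike.congr_fun (congrArg CommAlgCat.Hom.hom (hm i)) x)

/-- `D ⊗ -` preserves the product of copies of `R` indexed by `S`, so any family in `D ⊗ R` comes
from a single tensor. That tensor is found by lifting a cone with apex `R[X]`, which represents
elements. -/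
theorem exists_tensor_of_isRightAdjoint {S : Type u} (d : S → D) :
    ∃ w : D ⊗[R] (S → R), ∀ i, Algebra.TensorProduct.map (AlgHom.id R D)
      (Pi.evalAlgHom R (fun _ : S => R) i) w = d i ⊗ₜ 1 := by
  let h := isLimitOfPreserves (tensorLeft D) (powerFanIsLimit (R := R) S)
  let k : Cone (Discrete.functor (fun _ : S => CommAlgCat.of R R) ⋙ tensorLeft D) :=
    { pt := CommAlgCat.of R (Polynomial R)
      π := Discrete.natTrans fun i =>
        CommAlgCat.ofHom (Polynomial.aeval (R := R) (A := D ⊗[R] R) (d i.as ⊗ₜ[R] (1 : R))) }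
  refine ⟨(h.lift k).hom Polynomial.X, fun i => ?_⟩
  refine (DFunLike.congr_fun (congrArg CommAlgCat.Hom.hom (h.fac k ⟨i⟩)) Polynomial.X).trans ?_
  exact Polynomial.aeval_X _

/-- Apply the previous lemma to the family of all elements of `D`. The resulting tensor is a finite
sum `∑ x ⊗ φ`, and its component at `d` reads `d = ∑ φ d • x`, so the finitely many `x` generate
`D`. -/
theorem finite_of_isRightAdjoint : Module.Finite R D := by
  obtain ⟨w, hw⟩ := exists_tensor_of_isRightAdjoint D (fun d : D => d)
  classical
  obtain ⟨s, rfl⟩ := TensorProduct.exists_finset w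
  refine ⟨⟨s.image Prod.fst, eq_top_iff.mpr fun d _ => ?_⟩⟩
  have hd := congrArg (Algebra.TensorProduct.rid R R D) (hw d)
  simp only [map_sum, Algebra.TensorProduct.map_tmul, AlgHom.id_apply,
    Algebra.TensorProduct.rid_tmul, one_smul] at hd
  rw [← hd]
  exact Submodule.sum_mem _ fun x hx => Submodule.smul_mem _ _
    (Submodule.subset_span (Finset.mem_coe.mpr (Finset.mem_image_of_mem _ hx)))

-- For `r ≠ 0` the substitution `X ↦ r X` is a monomorphism, and right adjoints preserve
-- monomorphisms. But if `r • d = 0`, its tensor with `D` sends `d ⊗ X` to `0`.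
open Polynomial in
theorem isTorsionFree_of_isRightAdjoint [IsDomain R] : Module.IsTorsionFree R D := by
  apply Module.IsTorsionFree.of_smul_eq_zero
  intro r d hrd
  by_contra! hne
  let f : CommAlgCat.of R R[X] ⟶ CommAlgCat.of R R[X] :=
    CommAlgCat.ofHom (aeval (R := R) (C r * X : R[X]))
  have : Mono f := mono_of_injective f ((injective_iff_map_eq_zero _).mpr fun q hq =>
    (comp_C_mul_X_eq_zero_iff (mem_nonZeroDivisors_of_ne_zero hne.1)).mp
      ((comp_eq_aeval (p := q) (q := C r * X)).trans hq))
  have hinj := injective_of_mono ((tensorLeft D).map f)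
  have h0 : (d ⊗ₜ[R] (X : R[X])) = 0 := by
    apply hinj
    rw [map_zero]
    change d ⊗ₜ[R] aeval (R := R) (C r * X : R[X]) (X : R[X]) = 0
    rw [aeval_X, ← smul_eq_C_mul, ← TensorProduct.smul_tmul, hrd, TensorProduct.zero_tmul]
  -- Evaluation at `X = 1` recovers `d` from `d ⊗ X`.
  have h1 := congrArg (fun w => Algebra.TensorProduct.rid R R D
    (Algebra.TensorProduct.map (AlgHom.id R D) (aeval (R := R) (1 : R)) w)) h0
  simp at h1
  exact hne.2 h1

end

end CommAlgCat

end
noncomputable section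

namespace TangentoidTheory

/-- Iterates of a right adjoint are right adjoints, and these preserve limits. -/
theorem tensorPreservesFiberPowers_of_isRightAdjoint {C : Type u} [Category.{v} C]
    [MonoidalCategory C] (D : C) [(tensorLeft D).IsRightAdjoint] {E B : C} (q : E ⟶ B) :
    TensorPreservesFiberPowers D q where
  preserves k n := by
    have : (tensorPow D k).IsRightAdjoint := by
      induction k with
      | zero => exact inferInstanceAs (𝟭 C).IsRightAdjoint
      | succ k ih => exact inferInstanceAs (tensorPow D k ⋙ tensorLeft D).IsRightAdjoint
    infer_instance

/-! ### The trivial tangentoid -/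

section Trivial

variable {C : Type u} [Category.{v} C] {B : C} [HasFiberPowers (𝟙 B)]

theorem proj_id_eq {n : ℕ} (i j : Fin n) : proj (𝟙 B) i = proj (𝟙 B) j := by
  simpa using proj_comp (𝟙 B) i j

instance isIso_proj_id_zero : IsIso (proj (𝟙 B) (0 : Fin 2)) := by
  refine ⟨pair (𝟙 B) (𝟙 B) (𝟙 B) rfl, ?_, pair_proj_zero _ _ _ _⟩
  apply fiberPower_two_hom_ext
  · rw [Category.assoc, pair_proj_zero, Category.comp_id, Category.id_comp]
  · rw [Category.assoc, pair_proj_one, Category.comp_id, Category.id_comp, proj_id_eq]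

/-- The trivial tangentoid structure on the monoidal unit. -/
def trivialStr (C : Type u) [Category.{v} C] [MonoidalCategory C] [HasFiberPowers (𝟙 (𝟙_ C))]
    [TensorPreservesFiberPowers (𝟙_ C) (𝟙 (𝟙_ C))] : TangentoidStr (𝟙_ C) where
  p := 𝟙 _
  z := 𝟙 _
  s := proj _ 0
  z_p := Category.comp_id _
  s_p := rfl
  s_comm := by rw [pair_proj_zero, proj_id_eq]
  s_assoc := by simp only [pair_proj_zero]
  zero_s := by rw [pair_proj_zero, Category.comp_id]
  l := (λ_ _).inv
  c := 𝟙 _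
  l_p := by simp [unitors_inv_equal]
  z_l := by simp [unitors_inv_equal]
  s_l := by rw [tensorPair_proj_zero]
  c_p := by simp [unitors_equal]
  z_c := by simp [unitors_equal]
  s_c := by rw [tensorPair_proj_zero]
  l_l := by simp [unitors_inv_equal]
  c_c := Category.comp_id _
  braid := by simp
  l_c := Category.comp_id _
  l_c_c := by simp [unitors_inv_equal]
  lift_universal := by
    rw [tensorPair_proj_zero]
    refine IsPullback.of_horiz_isIso ⟨?_⟩
    simp [unitors_inv_equal]

end Trivial

/-! ### Augmented algebras and sums on elements -/

section Algebra

variable {R : Type u} [CommRing R] {D : CommAlgCat.{u} R}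

theorem unit_hom_apply (z : 𝟙_ (CommAlgCat.{u} R) ⟶ D) (r : R) : z.hom r = algebraMap R D r :=
  z.hom.commutes r

/-- The homomorphism `x ⊗ y ↦ p y • x`. -/
def contractRight {A : Type u} [CommRing A] [Algebra R A] (p : A →ₐ[R] R) : A ⊗[R] A →ₐ[R] A :=
  (Algebra.TensorProduct.rid R R A).toAlgHom.comp
    (Algebra.TensorProduct.map (AlgHom.id R A) p)

theorem contractRight_tmul {A : Type u} [CommRing A] [Algebra R A] (p : A →ₐ[R] R) (x y : A) :
    contractRight p (x ⊗ₜ y) = p y • x := rfl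

theorem whiskerLeft_unit_apply (p : D ⟶ 𝟙_ (CommAlgCat.{u} R)) (w : D ⊗[R] D) :
    (D ◁ p).hom w = contractRight p.hom w ⊗ₜ[R] (1 : R) :=
  ((Algebra.TensorProduct.rid R R D).symm_apply_apply ((D ◁ p).hom w)).symm

variable {p : D ⟶ 𝟙_ (CommAlgCat.{u} R)}

/-- The sum map of a square-zero extension, on elements. -/
def IsSum (s : fiberPower p 2 ⟶ D) : Prop :=
  ∀ y, s.hom y = (proj p 0).hom y + (proj p 1).hom y -
    algebraMap R D (p.hom ((proj p 0).hom y) : R)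

/-- The formula for `s` is linear, so it persists after tensoring with `D`: `D ◁ s` depends only on
the two projections, which for `tensorPair` are `f` and `g`. This allows the axioms involving
`tensorPair` to be checked on elements. -/
theorem tensorPair_whiskerLeft_apply [TensorPreservesFiberPowers D p]
    {s : fiberPower p 2 ⟶ D} (hs : IsSum s) {X : CommAlgCat.{u} R} (f g : X ⟶ D ⊗ D)
    (w : f ≫ D ◁ p = g ≫ D ◁ p) (x : X) :
    (tensorPair D p f g w ≫ D ◁ s).hom x =
      f.hom x + g.hom x - (contractRight p.hom (f.hom x : D ⊗[R] D)) ⊗ₜ[R] (1 : D) := by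
  have key : ∀ y : D ⊗[R] (fiberPower p 2 : CommAlgCat.{u} R), (D ◁ s).hom y =
      (D ◁ proj p 0).hom y + (D ◁ proj p 1).hom y -
        (contractRight p.hom ((D ◁ proj p 0).hom y : D ⊗[R] D)) ⊗ₜ[R] (1 : D) := by
    intro y
    induction y with
    | zero => simp
    | add a b ha hb =>
      simp only [map_add, ha, hb, TensorProduct.add_tmul]
      abel
    | tmul d y =>
      change d ⊗ₜ[R] (s.hom y : D) = d ⊗ₜ[R] ((proj p 0).hom y : D) +
        d ⊗ₜ[R] ((proj p 1).hom y : D) - ((p.hom ((proj p 0).hom y) : R) • d) ⊗ₜ[R] (1 : D)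
      rw [hs, TensorProduct.tmul_sub, TensorProduct.tmul_add, TensorProduct.smul_tmul,
        Algebra.algebraMap_eq_smul_one]
  refine (key _).trans ?_
  have h0 := DFunLike.congr_fun (congrArg CommAlgCat.Hom.hom (tensorPair_proj_zero D p f g w)) x
  have h1 := DFunLike.congr_fun (congrArg CommAlgCat.Hom.hom (tensorPair_proj_one D p f g w)) x
  rw [← h0, ← h1]
  rfl

theorem unit_comp_eq_id (z : 𝟙_ (CommAlgCat.{u} R) ⟶ D) (p : D ⟶ 𝟙_ (CommAlgCat.{u} R)) :
    z ≫ p = 𝟙 _ :=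
  CommAlgCat.isInitialSelf.hom_ext _ _

theorem augmentation_algebraMap (p : D ⟶ 𝟙_ (CommAlgCat.{u} R)) (r : R) :
    (p.hom (algebraMap R D r) : R) = r :=
  p.hom.commutes r

theorem id_comp_eq_comp_unit_comp (z : 𝟙_ (CommAlgCat.{u} R) ⟶ D)
    (p : D ⟶ 𝟙_ (CommAlgCat.{u} R)) : 𝟙 D ≫ p = (p ≫ z) ≫ p := by
  rw [Category.assoc, unit_comp_eq_id, Category.comp_id, Category.id_comp]

variable (p) in
theorem exists_fiberPower_two {x y : D} (hxy : (p.hom x : R) = p.hom y) :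
    ∃ w : (fiberPower p 2 : CommAlgCat.{u} R), (proj p 0).hom w = x ∧ (proj p 1).hom w = y := by
  let z : 𝟙_ (CommAlgCat.{u} R) ⟶ D := CommAlgCat.ofHom (Algebra.ofId R D)
  have hz : ∀ r : R, z.hom r = algebraMap R D r := unit_hom_apply z
  -- The decomposition is `(x, y) = (x, p x) + (0, y - p y)`, each summand being the value of a
  -- morphism into `D_2`.
  refine ⟨(pair p (𝟙 D) (p ≫ z) (id_comp_eq_comp_unit_comp z p)).hom x +
    (pair p (p ≫ z) (𝟙 D) (id_comp_eq_comp_unit_comp z p).symm).hom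
      (y - algebraMap R D (p.hom y : R)), ?_, ?_⟩
  · rw [map_add, proj_zero_pair_apply, proj_zero_pair_apply]
    change x + z.hom (p.hom _ : R) = x
    rw [map_sub, augmentation_algebraMap, sub_self, map_zero, add_zero]
  · rw [map_add, proj_one_pair_apply, proj_one_pair_apply]
    change z.hom (p.hom x : R) + (y - _) = y
    rw [hz, hxy, add_sub_cancel]

end Algebra

end TangentoidTheory

end
noncomputable section

namespace TangentoidTheory

/-! ### Coordinates on an augmented algebra with basis `1, e` -/

section Generator

variable {R : Type u} [CommRing R] {D : Type u} [CommRing D] [Algebra R D]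
  {p : D →ₐ[R] R} {q : D →ₗ[R] R} {e : D}

/-- `e` generates a complement of the scalars, on which the augmentation `p` vanishes, and `q` is
the corresponding coordinate. -/
structure IsGenerator (p : D →ₐ[R] R) (q : D →ₗ[R] R) (e : D) : Prop where
  map_eq_zero : p e = 0
  coord_eq_one : q e = 1
  eq_add_smul : ∀ d, d = p d • (1 : D) + q d • e

theorem IsGenerator.coord_one (he : IsGenerator p q e) : q 1 = 0 := by
  have h := congrArg q (he.eq_add_smul 1)
  simpa [he.coord_eq_one] using h

theorem IsGenerator.eq_smul (he : IsGenerator p q e) {d : D} (hd : p d = 0) : d = q d • e := by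
  conv_lhs => rw [he.eq_add_smul d, hd, zero_smul, zero_add]

theorem IsGenerator.eq_zero_of_combination (he : IsGenerator p q e) {a b : R}
    (h : algebraMap R D a + b • e = 0) : a = 0 ∧ b = 0 := by
  rw [Algebra.algebraMap_eq_smul_one] at h
  have h₁ := congrArg p h
  have h₂ := congrArg q h
  simp only [map_add, map_smul, map_one, map_zero, he.map_eq_zero, he.coord_one, he.coord_eq_one,
    smul_eq_mul, mul_one, mul_zero, add_zero, zero_add] at h₁ h₂
  exact ⟨h₁, h₂⟩

theorem exists_eq_combination (he : IsGenerator p q e) (w : D ⊗[R] D) :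
    ∃ a b c d : R, w = a • (1 ⊗ₜ 1) + b • (e ⊗ₜ 1) + c • (1 ⊗ₜ e) + d • (e ⊗ₜ e) := by
  induction w with
  | zero => exact ⟨0, 0, 0, 0, by simp⟩
  | add x y hx hy =>
    obtain ⟨a, b, c, d, rfl⟩ := hx
    obtain ⟨a', b', c', d', rfl⟩ := hy
    exact ⟨a + a', b + b', c + c', d + d', by simp only [add_smul]; abel⟩
  | tmul x y =>
    refine ⟨p x * p y, q x * p y, p x * q y, q x * q y, ?_⟩
    conv_lhs => rw [he.eq_add_smul x, he.eq_add_smul y]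
    simp only [TensorProduct.add_tmul, TensorProduct.tmul_add, TensorProduct.smul_tmul_smul]
    abel

/-- `p` and `q` form the basis dual to `1, e`, so their tensor products read off the four
coefficients. -/
theorem combination_coords (he : IsGenerator p q e) (a b c d : R) :
    let w : D ⊗[R] D := a • (1 ⊗ₜ 1) + b • (e ⊗ₜ 1) + c • (1 ⊗ₜ e) + d • (e ⊗ₜ e)
    let F (f g : D →ₗ[R] R) := LinearMap.mul' R R (TensorProduct.map f g w)
    F p.toLinearMap p.toLinearMap = a ∧ F q p.toLinearMap = b ∧ F p.toLinearMap q = c ∧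
      F q q = d := by
  simp [he.map_eq_zero, he.coord_eq_one, he.coord_one]

theorem combination_injective (he : IsGenerator p q e) {a b c d a' b' c' d' : R}
    (h : a • (1 ⊗ₜ 1) + b • (e ⊗ₜ 1) + c • (1 ⊗ₜ e) + d • (e ⊗ₜ e) =
      (a' • (1 ⊗ₜ 1) + b' • (e ⊗ₜ 1) + c' • (1 ⊗ₜ e) + d' • (e ⊗ₜ e) : D ⊗[R] D)) :
    a = a' ∧ b = b' ∧ c = c' ∧ d = d' := by
  have h1 := combination_coords he a b c d
  have h2 := combination_coords he a' b' c' d'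
  rw [h] at h1
  exact ⟨h1.1.symm.trans h2.1, h1.2.1.symm.trans h2.2.1, h1.2.2.1.symm.trans h2.2.2.1,
    h1.2.2.2.symm.trans h2.2.2.2⟩

theorem contractRight_combination (he : IsGenerator p q e) (a b c d : R) :
    contractRight p (a • (1 ⊗ₜ 1) + b • (e ⊗ₜ 1) + c • (1 ⊗ₜ e) + d • (e ⊗ₜ e)) =
      algebraMap R D a + b • e := by
  simp [contractRight_tmul, he.map_eq_zero, Algebra.algebraMap_eq_smul_one]

end Generator

/-- The sum of two homomorphisms to the dual numbers with the same scalar part. -/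
def dualAdd {R A : Type*} [CommRing R] [CommRing A] [Algebra R A] (f g : A →ₐ[R] R[ε])
    (h : ∀ x, TrivSqZeroExt.fst (g x) = TrivSqZeroExt.fst (f x)) : A →ₐ[R] R[ε] where
  toFun x := f x + g x - algebraMap R R[ε] (TrivSqZeroExt.fst (f x))
  map_one' := by simp
  map_zero' := by simp
  map_add' x y := by simp only [map_add, TrivSqZeroExt.fst_add]; abel
  -- The `ε`-parts of `f` and `g` are derivations over the same scalar part, and derivations can be
  -- added.
  map_mul' x y := by
    apply TrivSqZeroExt.ext
    · simp [h, TrivSqZeroExt.algebraMap_eq_inl]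
    · simp [h, TrivSqZeroExt.algebraMap_eq_inl]
      ring
  commutes' r := by simp [TrivSqZeroExt.algebraMap_eq_inl]

theorem fst_dualAdd {R A : Type*} [CommRing R] [CommRing A] [Algebra R A] (f g : A →ₐ[R] R[ε])
    (h : ∀ x, TrivSqZeroExt.fst (g x) = TrivSqZeroExt.fst (f x)) (x : A) :
    TrivSqZeroExt.fst (dualAdd f g h x) = TrivSqZeroExt.fst (f x) := by
  simp [dualAdd, h, TrivSqZeroExt.algebraMap_eq_inl]

theorem snd_dualAdd {R A : Type*} [CommRing R] [CommRing A] [Algebra R A] (f g : A →ₐ[R] R[ε])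
    (h : ∀ x, TrivSqZeroExt.fst (g x) = TrivSqZeroExt.fst (f x)) (x : A) :
    TrivSqZeroExt.snd (dualAdd f g h x) =
      TrivSqZeroExt.snd (f x) + TrivSqZeroExt.snd (g x) := by
  simp [dualAdd, TrivSqZeroExt.algebraMap_eq_inl]

/-! ### The tangentoid of dual numbers -/

section Dual

variable (R : Type u) [CommRing R]

/-- The dual numbers as an object of the category of commutative algebras. -/
abbrev dualNumbers : CommAlgCat.{u} R := CommAlgCat.of R R[ε]

/-- The projection `ε ↦ 0`. -/
abbrev dualProj : dualNumbers R ⟶ 𝟙_ (CommAlgCat.{u} R) :=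
  CommAlgCat.ofHom (TrivSqZeroExt.fstHom R R R)

theorem isGenerator_eps :
    IsGenerator (TrivSqZeroExt.fstHom R R R) (TrivSqZeroExt.sndHom R R) (ε : R[ε]) where
  map_eq_zero := TrivSqZeroExt.fst_inr R (1 : R)
  coord_eq_one := TrivSqZeroExt.snd_inr R (1 : R)
  eq_add_smul d := by ext <;> simp

/-- Addition of the `ε`-coordinates. -/
def dualSum : fiberPower (dualProj R) 2 ⟶ dualNumbers R :=
  CommAlgCat.ofHom (dualAdd (proj (dualProj R) 0).hom (proj (dualProj R) 1).hom
    fun y => comp_proj_one_apply y)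

theorem isSum_dualSum : IsSum (dualSum R) := fun _ => rfl

variable {R} in
theorem fst_dualSum (y : (fiberPower (dualProj R) 2 : CommAlgCat.{u} R)) :
    TrivSqZeroExt.fst ((dualSum R).hom y : R[ε]) =
      TrivSqZeroExt.fst ((proj (dualProj R) 0).hom y : R[ε]) :=
  fst_dualAdd _ _ (fun y => comp_proj_one_apply y) y

variable {R} in
theorem snd_dualSum (y : (fiberPower (dualProj R) 2 : CommAlgCat.{u} R)) :
    TrivSqZeroExt.snd ((dualSum R).hom y : R[ε]) =
      TrivSqZeroExt.snd ((proj (dualProj R) 0).hom y : R[ε]) +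
        TrivSqZeroExt.snd ((proj (dualProj R) 1).hom y : R[ε]) :=
  snd_dualAdd _ _ (fun y => comp_proj_one_apply y) y

variable {R} in
theorem dualHom_ext {X : CommAlgCat.{u} R} {f g : X ⟶ dualNumbers R}
    (h₁ : ∀ x, TrivSqZeroExt.fst (f.hom x : R[ε]) = TrivSqZeroExt.fst (g.hom x : R[ε]))
    (h₂ : ∀ x, TrivSqZeroExt.snd (f.hom x : R[ε]) = TrivSqZeroExt.snd (g.hom x : R[ε])) :
    f = g := by
  apply CommAlgCat.hom_ext
  exact AlgHom.ext fun x => TrivSqZeroExt.ext (h₁ x) (h₂ x)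

variable {R} in
theorem hom_ext_eps {X : CommAlgCat.{u} R} {f g : dualNumbers R ⟶ X}
    (h : f.hom (ε : R[ε]) = g.hom (ε : R[ε])) : f = g := by
  apply CommAlgCat.hom_ext
  exact DualNumber.algHom_ext h

variable {R} in
theorem hom_ext_tmul {X Y Z : CommAlgCat.{u} R} {f g : X ⊗ Y ⟶ Z}
    (h : ∀ x y, f.hom (x ⊗ₜ[R] y : X ⊗[R] Y) = g.hom (x ⊗ₜ[R] y : X ⊗[R] Y)) : f = g := by
  apply CommAlgCat.hom_ext
  exact Algebra.TensorProduct.ext' h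

/-- The vertical lift `ε ↦ ε ⊗ ε`. -/
def dualLift : dualNumbers R ⟶ dualNumbers R ⊗ dualNumbers R :=
  CommAlgCat.ofHom (DualNumber.lift
    ⟨(Algebra.ofId R (R[ε] ⊗[R] R[ε]), (ε : R[ε]) ⊗ₜ[R] (ε : R[ε])),
      by simp, fun _ => Commute.all _ _⟩)

theorem dualLift_eps : (dualLift R).hom (ε : R[ε]) = (ε : R[ε]) ⊗ₜ[R] (ε : R[ε]) :=
  DualNumber.lift_apply_eps _

instance : (tensorLeft (dualNumbers R)).IsRightAdjoint :=
  have : Module.Finite R (dualNumbers R) := inferInstanceAs (Module.Finite R (R × R))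
  have : Module.Free R (dualNumbers R) := inferInstanceAs (Module.Free R (R × R))
  CommAlgCat.isRightAdjoint_tensorLeft _

theorem dual_s_p : dualSum R ≫ dualProj R = proj (dualProj R) 0 ≫ dualProj R := by
  apply CommAlgCat.hom_ext
  exact AlgHom.ext fst_dualSum

variable {R} in
-- The zero coefficients are kept so that `contractRight_combination` applies verbatim.
theorem dual_lift_apply (y : dualNumbers R) : (dualLift R).hom y =
    (TrivSqZeroExt.fst (y : R[ε])) • ((1 : R[ε]) ⊗ₜ[R] (1 : R[ε])) +
      (0 : R) • ((ε : R[ε]) ⊗ₜ[R] (1 : R[ε])) +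
      (0 : R) • ((1 : R[ε]) ⊗ₜ[R] (ε : R[ε])) +
      (TrivSqZeroExt.snd (y : R[ε])) • ((ε : R[ε]) ⊗ₜ[R] (ε : R[ε])) := by
  conv_lhs => rw [(isGenerator_eps R).eq_add_smul y]
  rw [map_add, map_smul, map_smul, dualLift_eps, map_one, zero_smul, zero_smul, add_zero, add_zero]
  rfl

theorem dual_l_p : dualLift R ≫ dualNumbers R ◁ dualProj R =
    dualProj R ≫ CommAlgCat.ofHom (Algebra.ofId R R[ε]) ≫ (ρ_ (dualNumbers R)).inv := by
  apply hom_ext_eps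
  trans 0
  · change (dualNumbers R ◁ dualProj R).hom ((dualLift R).hom (ε : R[ε])) = 0
    rw [dualLift_eps]
    change (ε : R[ε]) ⊗ₜ[R] (TrivSqZeroExt.fst (ε : R[ε])) = 0
    rw [DualNumber.fst_eps, TensorProduct.tmul_zero]
  · change 0 = (ρ_ (dualNumbers R)).inv.hom (algebraMap R R[ε] (TrivSqZeroExt.fst (ε : R[ε])))
    rw [DualNumber.fst_eps, map_zero, map_zero]

theorem dual_s_comm : pair (dualProj R) (proj (dualProj R) 1) (proj (dualProj R) 0)
    (proj_comp (dualProj R) 1 0) ≫ dualSum R = dualSum R := by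
  refine dualHom_ext (fun x => ?_) fun x => ?_
  · rw [CommAlgCat.hom_comp, AlgHom.comp_apply, fst_dualSum, fst_dualSum, proj_zero_pair_apply]
    exact comp_proj_one_apply x
  · rw [CommAlgCat.hom_comp, AlgHom.comp_apply, snd_dualSum, snd_dualSum, proj_zero_pair_apply,
      proj_one_pair_apply, add_comm]

variable {R} in
theorem fst_pair_dualSum {X : CommAlgCat.{u} R} (f g : X ⟶ dualNumbers R)
    (w : f ≫ dualProj R = g ≫ dualProj R) (x : X) :
    TrivSqZeroExt.fst ((pair (dualProj R) f g w ≫ dualSum R).hom x : R[ε]) =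
      TrivSqZeroExt.fst (f.hom x : R[ε]) := by
  rw [CommAlgCat.hom_comp, AlgHom.comp_apply, fst_dualSum, proj_zero_pair_apply]

variable {R} in
theorem snd_pair_dualSum {X : CommAlgCat.{u} R} (f g : X ⟶ dualNumbers R)
    (w : f ≫ dualProj R = g ≫ dualProj R) (x : X) :
    TrivSqZeroExt.snd ((pair (dualProj R) f g w ≫ dualSum R).hom x : R[ε]) =
      TrivSqZeroExt.snd (f.hom x : R[ε]) + TrivSqZeroExt.snd (g.hom x : R[ε]) := by
  rw [CommAlgCat.hom_comp, AlgHom.comp_apply, snd_dualSum, proj_zero_pair_apply,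
    proj_one_pair_apply]

variable {R} in
-- In coordinates, `(a + d ε, a + c ε)` goes to `a (1 ⊗ 1) + c (1 ⊗ ε) + d (ε ⊗ ε)`.
theorem dual_lift_top_apply [TensorPreservesFiberPowers (dualNumbers R) (dualProj R)]
    (w : (proj (dualProj R) (0 : Fin 2) ≫ dualLift R) ≫ dualNumbers R ◁ dualProj R =
      (proj (dualProj R) 1 ≫ (λ_ (dualNumbers R)).inv ≫
        CommAlgCat.ofHom (Algebra.ofId R R[ε]) ▷ dualNumbers R) ≫ dualNumbers R ◁ dualProj R)
    (y : (fiberPower (dualProj R) 2 : CommAlgCat.{u} R)) :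
    (tensorPair (dualNumbers R) (dualProj R) _ _ w ≫ dualNumbers R ◁ dualSum R).hom y =
      (TrivSqZeroExt.fst ((proj (dualProj R) 0).hom y : R[ε])) • ((1 : R[ε]) ⊗ₜ[R] (1 : R[ε])) +
      (0 : R) • ((ε : R[ε]) ⊗ₜ[R] (1 : R[ε])) +
      (TrivSqZeroExt.snd ((proj (dualProj R) 1).hom y : R[ε])) •
        ((1 : R[ε]) ⊗ₜ[R] (ε : R[ε])) +
      (TrivSqZeroExt.snd ((proj (dualProj R) 0).hom y : R[ε])) •
        ((ε : R[ε]) ⊗ₜ[R] (ε : R[ε])) := by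
  rw [tensorPair_whiskerLeft_apply (isSum_dualSum R)]
  change (dualLift R).hom ((proj (dualProj R) 0).hom y) +
    (algebraMap R R[ε] 1) ⊗ₜ[R] ((proj (dualProj R) 1).hom y : R[ε]) -
    contractRight (TrivSqZeroExt.fstHom R R R)
      ((dualLift R).hom ((proj (dualProj R) 0).hom y) : R[ε] ⊗[R] R[ε]) ⊗ₜ[R] (1 : R[ε]) = _
  rw [dual_lift_apply ((proj (dualProj R) 0).hom y),
    contractRight_combination (isGenerator_eps R)]
  have h := (isGenerator_eps R).eq_add_smul ((proj (dualProj R) 1).hom y : R[ε])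
  have h' : TrivSqZeroExt.fstHom R R R ((proj (dualProj R) 1).hom y : R[ε]) =
    TrivSqZeroExt.fst ((proj (dualProj R) 0).hom y : R[ε]) := comp_proj_one_apply y
  rw [h'] at h
  have h₁ : (1 : R[ε]) ⊗ₜ[R] ((proj (dualProj R) 1).hom y : R[ε]) =
      TrivSqZeroExt.fst ((proj (dualProj R) 0).hom y : R[ε]) • ((1 : R[ε]) ⊗ₜ[R] (1 : R[ε])) +
        TrivSqZeroExt.snd ((proj (dualProj R) 1).hom y : R[ε]) •
          ((1 : R[ε]) ⊗ₜ[R] (ε : R[ε])) :=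
    (congrArg (fun d => (1 : R[ε]) ⊗ₜ[R] d) h).trans (by
      rw [TensorProduct.tmul_add, TensorProduct.tmul_smul, TensorProduct.tmul_smul]
      rfl)
  rw [map_one, h₁, zero_smul, zero_smul, zero_smul, add_zero, add_zero, add_zero,
    Algebra.algebraMap_eq_smul_one, ← TensorProduct.smul_tmul']
  abel

/-- A tensor is sent to a scalar by `id ⊗ p` exactly when its `ε ⊗ 1` coefficient vanishes. The top
map parametrises these tensors bijectively by the three remaining coefficients. -/
theorem dual_lift_universal [TensorPreservesFiberPowers (dualNumbers R) (dualProj R)]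
    (w : (proj (dualProj R) (0 : Fin 2) ≫ dualLift R) ≫ dualNumbers R ◁ dualProj R =
      (proj (dualProj R) 1 ≫ (λ_ (dualNumbers R)).inv ≫
        CommAlgCat.ofHom (Algebra.ofId R R[ε]) ▷ dualNumbers R) ≫ dualNumbers R ◁ dualProj R) :
    IsPullback
      (tensorPair (dualNumbers R) (dualProj R) _ _ w ≫ dualNumbers R ◁ dualSum R)
      (proj (dualProj R) 0 ≫ dualProj R) (dualNumbers R ◁ dualProj R)
      (CommAlgCat.ofHom (Algebra.ofId R R[ε]) ≫ (ρ_ (dualNumbers R)).inv) := by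
  refine CommAlgCat.isPullback_of_elements ?_ (fun x y h h' => ?_) fun t r h => ?_
  · rw [Category.assoc, ← whiskerLeft_comp, dual_s_p, whiskerLeft_comp, ← Category.assoc,
      tensorPair_proj_zero, Category.assoc, Category.assoc, dual_l_p]
  · rw [dual_lift_top_apply, dual_lift_top_apply] at h
    obtain ⟨h₁, -, h₂, h₃⟩ := combination_injective (isGenerator_eps R) h
    have hx : TrivSqZeroExt.fst ((proj (dualProj R) 1).hom x : R[ε]) =
      TrivSqZeroExt.fst ((proj (dualProj R) 0).hom x : R[ε]) := comp_proj_one_apply x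
    have hy : TrivSqZeroExt.fst ((proj (dualProj R) 1).hom y : R[ε]) =
      TrivSqZeroExt.fst ((proj (dualProj R) 0).hom y : R[ε]) := comp_proj_one_apply y
    exact fiberPower_two_ext (TrivSqZeroExt.ext h₁ h₃)
      (TrivSqZeroExt.ext (hx.trans (h₁.trans hy.symm)) h₂)
  · obtain ⟨a, b, c, d, rfl⟩ := exists_eq_combination (isGenerator_eps R) t
    have h₁ := congrArg (Algebra.TensorProduct.rid R R R[ε]) h
    change contractRight (TrivSqZeroExt.fstHom R R R) _ =
      Algebra.TensorProduct.rid R R R[ε] (algebraMap R R[ε] r ⊗ₜ[R] (1 : R)) at h₁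
    rw [contractRight_combination (isGenerator_eps R), Algebra.TensorProduct.rid_tmul,
      one_smul] at h₁
    have ha : a = r := by
      simpa [TrivSqZeroExt.algebraMap_eq_inl] using congrArg TrivSqZeroExt.fst h₁
    have hb : b = 0 := by
      simpa [TrivSqZeroExt.algebraMap_eq_inl] using congrArg TrivSqZeroExt.snd h₁
    obtain ⟨y, h₂, h₃⟩ := exists_fiberPower_two (dualProj R)
      (x := (TrivSqZeroExt.inl r + TrivSqZeroExt.inr d : R[ε]))
      (y := (TrivSqZeroExt.inl r + TrivSqZeroExt.inr c : R[ε])) (by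
        change TrivSqZeroExt.fst (_ : R[ε]) = TrivSqZeroExt.fst (_ : R[ε])
        simp)
    refine ⟨y, ?_, ?_⟩
    · rw [dual_lift_top_apply, h₂, h₃, ha, hb]
      simp
    · rw [CommAlgCat.hom_comp, AlgHom.comp_apply, h₂]
      change TrivSqZeroExt.fst (_ : R[ε]) = _
      simp

/-- The standard tangentoid structure on the dual numbers. -/
def dualStr : TangentoidStr (dualNumbers R) :=
  have : TensorPreservesFiberPowers (dualNumbers R) (dualProj R) :=
    tensorPreservesFiberPowers_of_isRightAdjoint _ _
  { p := dualProj R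
    z := CommAlgCat.ofHom (Algebra.ofId R R[ε])
    s := dualSum R
    z_p := unit_comp_eq_id _ _
    s_p := dual_s_p R
    s_comm := dual_s_comm R
    s_assoc := by
      refine dualHom_ext (fun x => ?_) fun x => ?_
      · rw [fst_pair_dualSum, fst_pair_dualSum, fst_pair_dualSum]
      · rw [snd_pair_dualSum, snd_pair_dualSum, snd_pair_dualSum, snd_pair_dualSum, add_assoc]
    zero_s := by
      refine dualHom_ext (fun x => ?_) fun x => ?_
      · rw [fst_pair_dualSum]
        exact TrivSqZeroExt.fst_inl _ _
      · rw [snd_pair_dualSum]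
        exact (congrArg (· + _) (TrivSqZeroExt.snd_inl _ _)).trans (zero_add _)
    l := dualLift R
    c := (β_ _ _).hom
    l_p := dual_l_p R
    -- `R` is initial, so parallel morphisms out of it agree.
    z_l := CommAlgCat.isInitialSelf.hom_ext _ _
    s_l := by
      apply CommAlgCat.hom_ext
      apply AlgHom.ext
      intro y
      rw [tensorPair_whiskerLeft_apply (isSum_dualSum R)]
      change (dualLift R).hom ((proj (dualProj R) 0).hom y) +
        (dualLift R).hom ((proj (dualProj R) 1).hom y) -
        contractRight (TrivSqZeroExt.fstHom R R R)
          ((dualLift R).hom ((proj (dualProj R) 0).hom y) : R[ε] ⊗[R] R[ε]) ⊗ₜ[R] (1 : R[ε]) =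
        (dualLift R).hom ((dualSum R).hom y)
      rw [dual_lift_apply ((proj (dualProj R) 0).hom y),
        contractRight_combination (isGenerator_eps R)]
      rw [← dual_lift_apply, isSum_dualSum, map_sub, map_add, AlgHom.commutes]
      simp
    c_p := hom_ext_tmul fun x y => by
      change (dualNumbers R ◁ dualProj R).hom ((y : R[ε]) ⊗ₜ[R] (x : R[ε])) =
        (ρ_ (dualNumbers R)).inv.hom (TrivSqZeroExt.fst x • (y : R[ε]))
      change (y : R[ε]) ⊗ₜ[R] (TrivSqZeroExt.fst x : R) =
        (TrivSqZeroExt.fst x • (y : R[ε])) ⊗ₜ[R] (1 : R)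
      rw [TensorProduct.smul_tmul, smul_eq_mul, mul_one]
    z_c := hom_ext_tmul fun x y => by
      change (y : R[ε]) ⊗ₜ[R] (algebraMap R R[ε] x) =
        ((x : R) • (y : R[ε])) ⊗ₜ[R] algebraMap R R[ε] 1
      rw [TensorProduct.smul_tmul, map_one, Algebra.algebraMap_eq_smul_one]
    s_c := hom_ext_tmul fun y d => by
      rw [tensorPair_whiskerLeft_apply (isSum_dualSum R)]
      change (d : R[ε]) ⊗ₜ[R] ((proj (dualProj R) 0).hom y : R[ε]) +
        (d : R[ε]) ⊗ₜ[R] ((proj (dualProj R) 1).hom y : R[ε]) -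
        (TrivSqZeroExt.fst ((proj (dualProj R) 0).hom y : R[ε]) • (d : R[ε])) ⊗ₜ[R] (1 : R[ε]) =
        (d : R[ε]) ⊗ₜ[R] ((dualSum R).hom y : R[ε])
      rw [isSum_dualSum, TensorProduct.tmul_sub, TensorProduct.tmul_add, TensorProduct.smul_tmul,
        Algebra.algebraMap_eq_smul_one]
      rfl
    l_l := hom_ext_eps (by
      change (dualNumbers R ◁ dualLift R).hom ((dualLift R).hom (ε : R[ε])) =
        (α_ (dualNumbers R) (dualNumbers R) (dualNumbers R)).hom.hom
          ((dualLift R ▷ dualNumbers R).hom ((dualLift R).hom (ε : R[ε])))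
      rw [dualLift_eps]
      change (ε : R[ε]) ⊗ₜ[R] ((dualLift R).hom (ε : R[ε])) =
        (α_ (dualNumbers R) (dualNumbers R) (dualNumbers R)).hom.hom
          (((dualLift R).hom (ε : R[ε])) ⊗ₜ[R] (ε : R[ε]))
      rw [dualLift_eps]
      rfl)
    c_c := hom_ext_tmul fun _ _ => rfl
    braid := by
      simp only [Category.assoc]
      have := BraidedCategory.yang_baxter (dualNumbers R) (dualNumbers R) (dualNumbers R)
      rw [this]
    l_c := hom_ext_eps (by
      change (β_ (dualNumbers R) (dualNumbers R)).hom.hom ((dualLift R).hom (ε : R[ε])) =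
        (dualLift R).hom (ε : R[ε])
      rw [dualLift_eps]
      rfl)
    l_c_c := by
      rw [← BraidedCategory.braiding_tensor_left_hom, BraidedCategory.braiding_naturality_left]
    lift_universal := dual_lift_universal R _ }

theorem isDualNumberStr_dualStr : IsDualNumberStr (dualStr R) where
  p_eq := rfl
  z_eq := rfl
  s_fst := fst_dualSum
  s_snd := snd_dualSum
  l_eps := dualLift_eps R
  c_eq := rfl

end Dual

end TangentoidTheory

end

noncomputable section

namespace TangentoidTheory

/-! ### Isomorphisms of tangentoids and the comparison with the trivial one -/

section Isomorphisms

variable {C : Type u} [Category.{v} C]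

theorem isIso_proj_one_fold {E B : C} (q : E ⟶ B) [HasFiberPowers q] :
    IsIso (proj q (0 : Fin 1)) := by
  refine ⟨WidePullback.lift q (fun _ => 𝟙 E) (fun _ => Category.id_comp _), ?_,
    WidePullback.lift_π _ _ _ _ _⟩
  apply WidePullback.hom_ext
  · intro j
    rw [Category.assoc, WidePullback.lift_π, Subsingleton.elim j 0, Category.comp_id,
      Category.id_comp]
  · rw [Category.assoc, WidePullback.lift_base, Category.id_comp]
    exact WidePullback.π_arrow (fun _ : Fin 1 => q) 0

variable [MonoidalCategory C]

/-- A morphism of tangentoids whose underlying morphism is invertible is an isomorphism. -/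
def Tangentoid.isoOfHom {T T' : Tangentoid C} (f : T ⟶ T') [IsIso (Tangentoid.Hom.hom f)] :
    T ≅ T' where
  hom := f
  inv :=
    { hom := inv (Tangentoid.Hom.hom f)
      hom_p := by rw [IsIso.inv_comp_eq, f.hom_p]
      z_hom := by rw [IsIso.comp_inv_eq, f.z_hom]
      hom_s := by
        refine (IsIso.eq_comp_inv _).mpr ((Category.assoc _ _ _).trans ?_)
        refine (congrArg (_ ≫ ·) f.hom_s.symm).trans ((Category.assoc _ _ _).symm.trans ?_)
        refine (congrArg (· ≫ T'.str.s) ?_).trans (Category.id_comp _)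
        apply fiberPower_two_hom_ext
        · rw [Category.assoc, pair_proj_zero, ← Category.assoc, pair_proj_zero, Category.assoc,
            IsIso.inv_hom_id, Category.comp_id, Category.id_comp]
        · rw [Category.assoc, pair_proj_one, ← Category.assoc, pair_proj_one, Category.assoc,
            IsIso.inv_hom_id, Category.comp_id, Category.id_comp]
      hom_l := by
        rw [IsIso.inv_comp_eq, ← Category.assoc, f.hom_l, Category.assoc,
          tensorHom_comp_tensorHom]
        simp
      hom_c := by
        rw [← cancel_epi (Tangentoid.Hom.hom f ⊗ₘ Tangentoid.Hom.hom f), ← Category.assoc,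
          tensorHom_comp_tensorHom, ← Category.assoc, f.hom_c, Category.assoc,
          tensorHom_comp_tensorHom]
        simp }
  hom_inv_id := Tangentoid.Hom.ext (IsIso.hom_inv_id _)
  inv_hom_id := Tangentoid.Hom.ext (IsIso.inv_hom_id _)

/-- The projection of a tangentoid is a morphism to the trivial tangentoid. -/
def homTrivial [HasFiberPowers (𝟙 (𝟙_ C))] [TensorPreservesFiberPowers (𝟙_ C) (𝟙 (𝟙_ C))]
    (T : Tangentoid C) : T ⟶ Tangentoid.mk _ (trivialStr C) where
  hom := T.str.p
  hom_p := Category.comp_id _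
  z_hom := T.str.z_p
  hom_s := by
    rw [T.str.s_p]
    exact pair_proj_zero _ _ _ _
  hom_l := by
    change _ ≫ (λ_ _).inv = _
    rw [tensorHom_def', ← Category.assoc, T.str.l_p, Category.assoc, Category.assoc,
      ← rightUnitor_inv_naturality, ← Category.assoc T.str.z, T.str.z_p, Category.id_comp,
      unitors_inv_equal]
  hom_c := by
    change _ ≫ 𝟙 _ = _
    rw [Category.comp_id]
    conv_rhs => rw [tensorHom_def', ← Category.assoc, T.str.c_p]
    rw [Category.assoc, Category.assoc, ← rightUnitor_inv_naturality,
      ← leftUnitor_naturality_assoc, unitors_equal, Iso.hom_inv_id, Category.comp_id,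
      MonoidalCategory.tensorHom_def]

/-- This is the case `n = 1`, transported along `D_1 ≅ D`. -/
theorem Tangentoid.IsCoexponentiable.isRightAdjoint {T : Tangentoid C}
    (h : T.IsCoexponentiable) : (tensorLeft T.obj).IsRightAdjoint :=
  have := h 1
  have := isIso_proj_one_fold T.str.p
  Functor.isRightAdjoint_of_iso
    ((tensoringLeft C).mapIso (asIso (proj T.str.p (0 : Fin 1))))

end Isomorphisms

/-! ### Classification of coexponentiable tangentoids -/

section Classification

variable {R : Type u} [CommRing R] {D : CommAlgCat.{u} R}

/-- The unit law and commutativity determine `s` on the pairs `(x, p x)` and `(p y, y)`. With the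
scalars, these span `D_2` additively. -/
theorem AdditiveBundle.isSum (t : AdditiveBundle D (𝟙_ (CommAlgCat.{u} R))) : IsSum t.s := by
  intro y
  let i₁ := pair t.p (t.p ≫ t.z) (𝟙 D) (id_comp_eq_comp_unit_comp t.z t.p).symm
  let i₀ := pair t.p (𝟙 D) (t.p ≫ t.z) (id_comp_eq_comp_unit_comp t.z t.p)
  have h₁ : i₁ ≫ t.s = 𝟙 D := t.zero_s
  have h₀ : i₀ ≫ t.s = 𝟙 D := by
    rw [← t.zero_s]
    conv_rhs => rw [← t.s_comm, ← Category.assoc]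
    congr 1
    apply fiberPower_two_hom_ext
    · rw [Category.assoc, pair_proj_zero, pair_proj_zero, pair_proj_one]
    · rw [Category.assoc, pair_proj_one, pair_proj_one, pair_proj_zero]
  -- With `r = p x = p y`, this is `(x, y) = (x, r) + (r, y) - (r, r)`.
  have hy : y = i₀.hom ((proj t.p 0).hom y) + i₁.hom ((proj t.p 1).hom y) -
      algebraMap R _ (t.p.hom ((proj t.p 0).hom y) : R) := by
    apply fiberPower_two_ext
    · rw [map_sub, map_add, proj_zero_pair_apply, proj_zero_pair_apply, AlgHom.commutes]
      change _ = (proj t.p 0).hom y + t.z.hom (t.p.hom ((proj t.p 1).hom y) : R) - _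
      rw [unit_hom_apply, comp_proj_one_apply, add_sub_cancel_right]
    · rw [map_sub, map_add, proj_one_pair_apply, proj_one_pair_apply, AlgHom.commutes]
      change _ = t.z.hom (t.p.hom ((proj t.p 0).hom y) : R) + (proj t.p 1).hom y - _
      rw [unit_hom_apply, add_sub_cancel_left]
  have e₀ (x : D) : t.s.hom (i₀.hom x) = x :=
    DFunLike.congr_fun (congrArg CommAlgCat.Hom.hom h₀) x
  have e₁ (x : D) : t.s.hom (i₁.hom x) = x :=
    DFunLike.congr_fun (congrArg CommAlgCat.Hom.hom h₁) x
  conv_lhs => rw [hy]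
  rw [map_sub, map_add, e₀, e₁, AlgHom.commutes]

/-- `s` is multiplicative with `s (a, 0) = a` and `s (0, b) = b`, while `(a, 0) * (0, b) = 0`. -/
theorem AdditiveBundle.mul_eq_zero (t : AdditiveBundle D (𝟙_ (CommAlgCat.{u} R))) {a b : D}
    (ha : (t.p.hom a : R) = 0) (hb : (t.p.hom b : R) = 0) : a * b = 0 := by
  obtain ⟨x, hx₀, hx₁⟩ := exists_fiberPower_two t.p (x := a) (y := 0)
    (ha.trans (map_zero t.p.hom).symm)
  obtain ⟨y, hy₀, hy₁⟩ := exists_fiberPower_two t.p (x := 0) (y := b)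
    ((map_zero t.p.hom).trans hb.symm)
  have hxy : x * y = 0 := by
    apply fiberPower_two_ext
    · rw [map_mul, hy₀, mul_zero, map_zero]
    · rw [map_mul, hx₁, zero_mul, map_zero]
  have hx : t.s.hom x = a := by
    rw [t.isSum, hx₀, hx₁, ha, map_zero, add_zero, sub_zero]
  have hy : t.s.hom y = b := by
    rw [t.isSum, hy₀, hy₁, map_zero]
    exact (congrArg _ (map_zero (algebraMap R D))).trans (by rw [zero_add, sub_zero])
  rw [← hx, ← hy, ← map_mul, hxy, map_zero]

/-- Compatibility with `z` gives `c (1 ⊗ d) = d ⊗ 1`, and `c ∘ c = id` gives the other factor. The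
two factors generate `D ⊗ D`. -/
theorem TangentoidStr.flip_eq_braiding (t : TangentoidStr D) : t.c = (β_ D D).hom := by
  have h₁ (d : D) : t.c.hom ((1 : D) ⊗ₜ[R] d : D ⊗[R] D) = (d ⊗ₜ[R] (1 : D) : D ⊗[R] D) := by
    have h := DFunLike.congr_fun (congrArg CommAlgCat.Hom.hom t.z_c) ((1 : R) ⊗ₜ[R] d)
    change t.c.hom ((t.z.hom (1 : R) : D) ⊗ₜ[R] d) = ((1 : R) • d) ⊗ₜ[R] (t.z.hom (1 : R) : D) at h
    rwa [unit_hom_apply, map_one, one_smul] at h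
  have h₂ (d : D) : t.c.hom (d ⊗ₜ[R] (1 : D) : D ⊗[R] D) = ((1 : D) ⊗ₜ[R] d : D ⊗[R] D) := by
    rw [← h₁]
    exact DFunLike.congr_fun (congrArg CommAlgCat.Hom.hom t.c_c) _
  apply CommAlgCat.hom_ext
  apply Algebra.TensorProduct.ext
  · exact AlgHom.ext h₂
  · exact AlgHom.ext h₁

theorem TangentoidStr.contractRight_lift (t : TangentoidStr D) (d : D) :
    contractRight t.p.hom (t.l.hom d : D ⊗[R] D) = algebraMap R D (t.p.hom d : R) := by
  have h := DFunLike.congr_fun (congrArg CommAlgCat.Hom.hom t.l_p) d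
  have h' := congrArg (Algebra.TensorProduct.rid R R D) h
  change contractRight t.p.hom (t.l.hom d : D ⊗[R] D) =
    (1 : R) • (t.z.hom (t.p.hom d : R) : D) at h'
  rw [h', one_smul, unit_hom_apply]

theorem TangentoidStr.braiding_lift (t : TangentoidStr D) (d : D) :
    Algebra.TensorProduct.comm R D D (t.l.hom d : D ⊗[R] D) = t.l.hom d := by
  have h := t.l_c
  rw [t.flip_eq_braiding] at h
  exact DFunLike.congr_fun (congrArg CommAlgCat.Hom.hom h) d

theorem TangentoidStr.exists_lift_universal_apply (t : TangentoidStr D) :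
    ∃ f : fiberPower t.p 2 ⟶ D ⊗ D,
      IsPullback f (proj t.p 0 ≫ t.p) (D ◁ t.p) (t.z ≫ (ρ_ D).inv) ∧
      ∀ y, f.hom y = (t.l.hom ((proj t.p 0).hom y) : D ⊗[R] D) +
        (1 : D) ⊗ₜ[R] ((proj t.p 1).hom y : D) -
        (algebraMap R D (t.p.hom ((proj t.p 0).hom y) : R)) ⊗ₜ[R] (1 : D) := by
  refine ⟨_, t.lift_universal, fun y => ?_⟩
  rw [tensorPair_whiskerLeft_apply t.isSum]
  change (t.l.hom ((proj t.p 0).hom y) : D ⊗[R] D) +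
    (t.z.hom (1 : R) : D) ⊗ₜ[R] ((proj t.p 1).hom y : D) -
    contractRight t.p.hom (t.l.hom ((proj t.p 0).hom y) : D ⊗[R] D) ⊗ₜ[R] (1 : D) = _
  rw [t.contractRight_lift, unit_hom_apply, map_one]

/-- This is the existence half of the universality of the lift, over the scalar `0`. The next lemma
is the uniqueness half. -/
theorem TangentoidStr.exists_eq_lift_add (t : TangentoidStr D) {w : D ⊗[R] D}
    (hw : contractRight t.p.hom w = 0) :
    ∃ a b : D, (t.p.hom a : R) = 0 ∧ (t.p.hom b : R) = 0 ∧
      (t.l.hom a : D ⊗[R] D) + (1 : D) ⊗ₜ[R] b = w := by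
  obtain ⟨f, hf, hfy⟩ := t.exists_lift_universal_apply
  obtain ⟨y, hy, hy'⟩ := CommAlgCat.exists_of_isPullback hf w (0 : R) (by
    rw [whiskerLeft_unit_apply, hw, TensorProduct.zero_tmul]
    exact (map_zero (t.z ≫ (ρ_ D).inv).hom).symm)
  have h₀ : (t.p.hom ((proj t.p 0).hom y) : R) = 0 := hy'
  refine ⟨_, _, h₀, (comp_proj_one_apply y).trans h₀, ?_⟩
  rw [← hy, hfy, h₀, map_zero, TensorProduct.zero_tmul, sub_zero]

theorem TangentoidStr.eq_zero_of_lift_add (t : TangentoidStr D) {a b : D}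
    (ha : (t.p.hom a : R) = 0) (hb : (t.p.hom b : R) = 0)
    (h : (t.l.hom a : D ⊗[R] D) + (1 : D) ⊗ₜ[R] b = 0) : a = 0 ∧ b = 0 := by
  obtain ⟨f, hf, hfy⟩ := t.exists_lift_universal_apply
  obtain ⟨y, rfl, rfl⟩ := exists_fiberPower_two t.p (ha.trans hb.symm)
  have hy : y = 0 := by
    apply CommAlgCat.ext_of_isPullback hf
    · rw [hfy, h, ha, map_zero, map_zero, TensorProduct.zero_tmul, sub_zero]
    · exact ha.trans (map_zero (proj t.p 0 ≫ t.p).hom).symm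
  rw [hy, map_zero, map_zero]
  exact ⟨rfl, rfl⟩

theorem finrank_ker_add_finrank [IsDomain R] {M N : Type u} [AddCommGroup M] [Module R M]
    [AddCommGroup N] [Module R N] [Module.Finite R M] (f : M →ₗ[R] N)
    (hf : Function.Surjective f) :
    Module.finrank R (LinearMap.ker f) + Module.finrank R N = Module.finrank R M := by
  rw [← (f.quotKerEquivOfSurjective hf).finrank_eq, add_comm]
  exact Submodule.finrank_quotient_add_finrank _

/-- The linear map underlying an augmentation. -/
abbrev augmentation (p : D ⟶ 𝟙_ (CommAlgCat.{u} R)) : D →ₗ[R] R :=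
  AlgHom.toLinearMap (A := D) (B := R) p.hom

/-- The homomorphism from the dual numbers that sends `ε` to an element of square zero. -/
def dualHom (e : D) (he : e * e = 0) : dualNumbers R ⟶ D :=
  CommAlgCat.ofHom (DualNumber.lift ⟨(Algebra.ofId R D, e), he, fun _ => Commute.all _ _⟩)

theorem dualHom_eps (e : D) (he : e * e = 0) : (dualHom e he).hom (ε : R[ε]) = e :=
  DualNumber.lift_apply_eps _

theorem dualHom_apply (e : D) (he : e * e = 0) (x : R[ε]) : (dualHom e he).hom x =
    TrivSqZeroExt.fst x • (1 : D) + TrivSqZeroExt.snd x • e := by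
  conv_lhs => rw [(isGenerator_eps R).eq_add_smul x]
  rw [map_add, map_smul, map_smul, dualHom_eps, map_one]
  rfl

theorem isIso_dualHom {p : D →ₐ[R] R} {q : D →ₗ[R] R} {e : D} (h : IsGenerator p q e)
    (he : e * e = 0) : IsIso (dualHom e he) := by
  rw [ConcreteCategory.isIso_iff_bijective]
  constructor
  · intro x y hxy
    have hxy' : (dualHom e he).hom x = (dualHom e he).hom y := hxy
    rw [dualHom_apply, dualHom_apply] at hxy'
    have h₁ := congrArg p hxy'
    have h₂ := congrArg q hxy'
    simp only [map_add, map_smul, map_one, h.map_eq_zero, h.coord_one, h.coord_eq_one, smul_eq_mul,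
      mul_one, mul_zero, add_zero, zero_add] at h₁ h₂
    exact TrivSqZeroExt.ext h₁ h₂
  · intro d
    refine ⟨(TrivSqZeroExt.inl (p d) + TrivSqZeroExt.inr (q d) : R[ε]), ?_⟩
    refine (dualHom_apply e he _).trans ?_
    simp only [TrivSqZeroExt.fst_add, TrivSqZeroExt.snd_add, TrivSqZeroExt.fst_inl,
      TrivSqZeroExt.snd_inl, TrivSqZeroExt.fst_inr, TrivSqZeroExt.snd_inr, add_zero, zero_add]
    exact (h.eq_add_smul d).symm

theorem dualHom_comp (p : D ⟶ 𝟙_ (CommAlgCat.{u} R)) {e : D} (hp : (p.hom e : R) = 0)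
    (he : e * e = 0) : dualHom e he ≫ p = dualProj R := by
  apply hom_ext_eps
  change p.hom ((dualHom e he).hom (ε : R[ε])) = TrivSqZeroExt.fst (ε : R[ε])
  rw [dualHom_eps, DualNumber.fst_eps]
  exact hp

theorem pair_dualHom_comp (t : AdditiveBundle D (𝟙_ (CommAlgCat.{u} R))) {e : D}
    (hp : (t.p.hom e : R) = 0) (he : e * e = 0)
    (w : (proj (dualProj R) 0 ≫ dualHom e he) ≫ t.p = (proj (dualProj R) 1 ≫ dualHom e he) ≫ t.p) :
    pair t.p _ _ w ≫ t.s = dualSum R ≫ dualHom e he := by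
  apply CommAlgCat.hom_ext
  apply AlgHom.ext
  intro y
  refine (t.isSum _).trans ?_
  have h : t.p.hom ((dualHom e he).hom ((proj (dualProj R) 0).hom y)) =
      (dualProj R).hom ((proj (dualProj R) 0).hom y) :=
    DFunLike.congr_fun (congrArg CommAlgCat.Hom.hom (dualHom_comp t.p hp he)) _
  have h₀ := proj_zero_pair_apply _ _ w y
  have h₁ := proj_one_pair_apply _ _ w y
  refine (congrArg₂ (fun a b : D => a + b - algebraMap R D (t.p.hom a : R)) h₀ h₁).trans ?_
  change (dualHom e he).hom ((proj (dualProj R) 0).hom y) +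
    (dualHom e he).hom ((proj (dualProj R) 1).hom y) -
    algebraMap R D (t.p.hom ((dualHom e he).hom ((proj (dualProj R) 0).hom y)) : R) =
    (dualHom e he).hom ((dualSum R).hom y)
  rw [isSum_dualSum, map_sub, map_add, AlgHom.commutes, h]

/-- The comparison of the standard tangentoid on the dual numbers with a tangentoid whose lift
sends a generator `e` to `e ⊗ e`. -/
def dualTangentoidHom (t : TangentoidStr D) {e : D} (hp : (t.p.hom e : R) = 0) (he : e * e = 0)
    (hl : t.l.hom e = (e ⊗ₜ[R] e : D ⊗[R] D)) :
    Tangentoid.mk _ (dualStr R) ⟶ Tangentoid.mk D t where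
  hom := dualHom e he
  hom_p := dualHom_comp t.p hp he
  z_hom := CommAlgCat.isInitialSelf.hom_ext _ _
  hom_s := pair_dualHom_comp t.toAdditiveBundle hp he _
  hom_l := by
    apply hom_ext_eps
    change t.l.hom ((dualHom e he).hom (ε : R[ε])) =
      (dualHom e he ⊗ₘ dualHom e he).hom ((dualLift R).hom (ε : R[ε]))
    rw [dualHom_eps, dualLift_eps, hl]
    change _ = (dualHom e he).hom (ε : R[ε]) ⊗ₜ[R] (dualHom e he).hom (ε : R[ε])
    rw [dualHom_eps]
  hom_c := by
    change _ ≫ t.c = (β_ _ _).hom ≫ _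
    rw [t.flip_eq_braiding, BraidedCategory.braiding_naturality]

/-- Compatibility with `p` removes the coefficients of `1 ⊗ 1` and `e ⊗ 1` from `l e`, and symmetry
then removes that of `1 ⊗ e`. What remains is `d • (e ⊗ e)`, and rescaling `e` by the unit `d`
absorbs the factor. -/
theorem TangentoidStr.exists_lift_eq_tmul (t : TangentoidStr D) {q : D →ₗ[R] R} {e : D}
    (he : IsGenerator (D := D) t.p.hom q e) :
    ∃ (q' : D →ₗ[R] R) (e' : D), IsGenerator (D := D) t.p.hom q' e' ∧
      t.l.hom e' = (e' ⊗ₜ[R] e' : D ⊗[R] D) := by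
  have hpe : (t.p.hom e : R) = 0 := he.map_eq_zero
  obtain ⟨a, b, c, d, hl⟩ := exists_eq_combination he (t.l.hom e : D ⊗[R] D)
  have h₁ := t.contractRight_lift e
  rw [hl, contractRight_combination he, hpe, map_zero] at h₁
  obtain ⟨ha, hb⟩ := he.eq_zero_of_combination h₁
  have h₂ := t.braiding_lift e
  rw [hl] at h₂
  simp only [map_add, map_smul, Algebra.TensorProduct.comm_tmul] at h₂
  rw [add_assoc (a • _), add_comm (b • _), ← add_assoc] at h₂
  obtain ⟨-, hcb, -, -⟩ := combination_injective he h₂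
  rw [ha, hcb, hb, zero_smul, zero_smul, zero_smul, zero_add, zero_add, zero_add] at hl
  -- Writing `e ⊗ e` as `l x + 1 ⊗ y` with `x = q x • e` exhibits `q x` as an inverse of `d`.
  obtain ⟨x, y, hx, hy, hxy⟩ := t.exists_eq_lift_add (w := e ⊗ₜ[R] e)
    (by rw [contractRight_tmul, hpe, zero_smul])
  have hd : q x * d = 1 := by
    rw [he.eq_smul hx, he.eq_smul hy, map_smul, hl, TensorProduct.tmul_smul, smul_smul] at hxy
    have h : (0 : R) • ((1 : D) ⊗ₜ[R] (1 : D)) + (0 : R) • (e ⊗ₜ[R] (1 : D)) +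
        q y • ((1 : D) ⊗ₜ[R] e) + (q x * d) • (e ⊗ₜ[R] e) =
        (0 : R) • ((1 : D) ⊗ₜ[R] (1 : D)) + (0 : R) • (e ⊗ₜ[R] (1 : D)) +
        (0 : R) • ((1 : D) ⊗ₜ[R] e) + (1 : R) • (e ⊗ₜ[R] e) := by
      simp only [zero_smul, zero_add, one_smul]
      exact (add_comm _ _).trans hxy
    exact (combination_injective he h).2.2.2
  refine ⟨q x • q, d • e, ⟨?_, ?_, fun z => ?_⟩, ?_⟩
  · change (t.p.hom (d • e) : R) = 0
    rw [map_smul, hpe]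
    exact smul_zero d
  · rw [LinearMap.smul_apply, map_smul, he.coord_eq_one, smul_eq_mul, smul_eq_mul, mul_one, hd]
  · rw [LinearMap.smul_apply, smul_eq_mul, smul_smul, mul_right_comm, hd, one_mul]
    exact he.eq_add_smul z
  · rw [map_smul, hl, TensorProduct.tmul_smul, TensorProduct.smul_tmul']

variable [IsDomain R]

/-- The map `(a, b) ↦ l a + 1 ⊗ b` on the augmentation ideal is bijective onto the kernel of
`contractRight`. -/
def TangentoidStr.kerEquiv (t : TangentoidStr D) :
    (LinearMap.ker (augmentation t.p) × LinearMap.ker (augmentation t.p)) ≃ₗ[R]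
      LinearMap.ker (contractRight t.p.hom).toLinearMap :=
  let l : D →ₗ[R] D ⊗[R] D := AlgHom.toLinearMap (A := D) (B := D ⊗[R] D) t.l.hom
  let A := LinearMap.ker (augmentation t.p)
  let f : A × A →ₗ[R] D ⊗[R] D :=
    (l ∘ₗ A.subtype).coprod (TensorProduct.mk R D D 1 ∘ₗ A.subtype)
  LinearEquiv.ofBijective
    (f.codRestrict _ (fun x => by
      obtain ⟨⟨a, ha⟩, ⟨b, hb⟩⟩ := x
      change contractRight t.p.hom ((t.l.hom a : D ⊗[R] D) + (1 : D) ⊗ₜ[R] b) = 0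
      have ha' : (t.p.hom a : R) = 0 := ha
      have hb' : (t.p.hom b : R) = 0 := hb
      rw [map_add, t.contractRight_lift, ha', contractRight_tmul, hb', map_zero, zero_smul,
        add_zero]))
    ⟨by
      rw [injective_iff_map_eq_zero]
      rintro ⟨⟨a, ha⟩, ⟨b, hb⟩⟩ h
      obtain ⟨rfl, rfl⟩ := t.eq_zero_of_lift_add ha hb (congrArg Subtype.val h)
      rfl, by
      rintro ⟨w, hw⟩
      obtain ⟨a, b, ha, hb, h⟩ := t.exists_eq_lift_add hw
      exact ⟨⟨⟨a, ha⟩, ⟨b, hb⟩⟩, Subtype.ext h⟩⟩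

/-- If the augmentation ideal has rank `n`, then `D` has rank `n + 1`, and `kerEquiv` gives the
kernel of `contractRight` rank `2n`. Rank-nullity on `D ⊗ D` then yields `n² = n`. -/
theorem TangentoidStr.finrank_ker_eq [Module.Finite R D] [Module.Free R D]
    (t : TangentoidStr D) [Module.Finite R (LinearMap.ker (augmentation t.p))]
    [Module.Free R (LinearMap.ker (augmentation t.p))] :
    Module.finrank R (LinearMap.ker (augmentation t.p)) = 0 ∨
      Module.finrank R (LinearMap.ker (augmentation t.p)) = 1 := by
  have h₁ := finrank_ker_add_finrank (augmentation t.p)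
    fun r => ⟨algebraMap R D r, augmentation_algebraMap t.p r⟩
  have h₂ := finrank_ker_add_finrank (contractRight t.p.hom).toLinearMap fun d =>
    ⟨d ⊗ₜ 1, by
      change contractRight t.p.hom (d ⊗ₜ[R] (1 : D)) = d
      have h : (t.p.hom (1 : D) : R) = 1 := map_one t.p.hom
      rw [contractRight_tmul, h, one_smul]⟩
  rw [← t.kerEquiv.finrank_eq, Module.finrank_prod, Module.finrank_tensorProduct, ← h₁,
    Module.finrank_self] at h₂
  have h₃ : Module.finrank R (LinearMap.ker (augmentation t.p)) *
      Module.finrank R (LinearMap.ker (augmentation t.p)) =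
      Module.finrank R (LinearMap.ker (augmentation t.p)) * 1 := by linarith
  rcases Nat.eq_zero_or_pos (Module.finrank R (LinearMap.ker (augmentation t.p))) with h | h
  · exact Or.inl h
  · exact Or.inr (Nat.eq_of_mul_eq_mul_left h h₃)

/-- `d ↦ d - p d` projects `D` onto the augmentation ideal, which is identified with `R` by its
rank. The generator corresponds to `1`. -/
theorem exists_isGenerator (p : D ⟶ 𝟙_ (CommAlgCat.{u} R))
    [Module.Finite R (LinearMap.ker (augmentation p))]
    [Module.Free R (LinearMap.ker (augmentation p))]
    (h : Module.finrank R (LinearMap.ker (augmentation p)) = 1) :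
    ∃ (q : D →ₗ[R] R) (e : D), IsGenerator (D := D) p.hom q e := by
  let φ : LinearMap.ker (augmentation p) ≃ₗ[R] R :=
    LinearEquiv.ofFinrankEq _ _ (h.trans (Module.finrank_self R).symm)
  let π : D →ₗ[R] LinearMap.ker (augmentation p) :=
    (LinearMap.id - (Algebra.linearMap R D) ∘ₗ augmentation p).codRestrict _ (fun d => by
      change (p.hom (d - algebraMap R D (p.hom d : R)) : R) = 0
      rw [map_sub, augmentation_algebraMap, sub_self])
  have hπ (a : LinearMap.ker (augmentation p)) : π a = a := by
    apply Subtype.ext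
    change (a : D) - algebraMap R D (p.hom (a : D) : R) = a
    have ha : (p.hom (a : D) : R) = 0 := a.2
    rw [ha, map_zero, sub_zero]
  refine ⟨φ.toLinearMap ∘ₗ π, φ.symm 1, ⟨(φ.symm 1).2, ?_, fun d => ?_⟩⟩
  · change φ (π _) = 1
    rw [hπ, φ.apply_symm_apply]
  · change d = (p.hom d : R) • (1 : D) + φ (π d) • ((φ.symm 1 : LinearMap.ker _) : D)
    rw [← Submodule.coe_smul, ← map_smul, smul_eq_mul, mul_one, φ.symm_apply_apply]
    change d = _ + (d - algebraMap R D (p.hom d : R))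
    rw [Algebra.algebraMap_eq_smul_one, add_sub_cancel]

variable [IsPrincipalIdealRing R]

theorem Tangentoid.nonempty_iso_or_nonempty_iso
    [TensorPreservesFiberPowers (𝟙_ (CommAlgCat.{u} R)) (𝟙 (𝟙_ (CommAlgCat.{u} R)))]
    (T : Tangentoid (CommAlgCat.{u} R)) (h : T.IsCoexponentiable) :
    Nonempty (T ≅ Tangentoid.mk _ (trivialStr (CommAlgCat.{u} R))) ∨
      Nonempty (T ≅ Tangentoid.mk _ (dualStr R)) := by
  obtain ⟨D, t⟩ := T
  have : (tensorLeft D).IsRightAdjoint := h.isRightAdjoint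
  have := CommAlgCat.finite_of_isRightAdjoint D
  have := CommAlgCat.isTorsionFree_of_isRightAdjoint D
  have : Module.Free R D := Module.free_of_finite_type_torsion_free'
  rcases t.finrank_ker_eq with h | h
  · left
    have : IsIso (homTrivial (Tangentoid.mk D t)).hom := by
      rw [ConcreteCategory.isIso_iff_bijective]
      refine ⟨?_, fun r => ⟨algebraMap R D r, augmentation_algebraMap t.p r⟩⟩
      have h' := Submodule.finrank_eq_zero.mp h
      exact LinearMap.ker_eq_bot.mp h'
    exact ⟨Tangentoid.isoOfHom (homTrivial (Tangentoid.mk D t))⟩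
  · right
    obtain ⟨q, e, he⟩ := exists_isGenerator t.p h
    obtain ⟨q', e', he', hl⟩ := t.exists_lift_eq_tmul he
    have hsq : e' * e' = 0 := t.mul_eq_zero he'.map_eq_zero he'.map_eq_zero
    have : IsIso (dualTangentoidHom t he'.map_eq_zero hsq hl).hom := isIso_dualHom he' hsq
    exact ⟨(Tangentoid.isoOfHom (dualTangentoidHom t he'.map_eq_zero hsq hl)).symm⟩

/-- Each `D_n` embeds in `R × Dⁿ`, so it is finite and torsion-free, hence free, and Weil
restriction applies. -/
theorem isCoexponentiable_of_finite (T : Tangentoid (CommAlgCat.{u} R)) [Module.Finite R T.obj]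
    [Module.Free R T.obj] : T.IsCoexponentiable := fun n => by
  have : Module.Finite R (𝟙_ (CommAlgCat.{u} R) : CommAlgCat.{u} R) :=
    inferInstanceAs (Module.Finite R R)
  have : Module.IsTorsionFree R (𝟙_ (CommAlgCat.{u} R) : CommAlgCat.{u} R) :=
    inferInstanceAs (Module.IsTorsionFree R R)
  have := finite_fiberPower (q := T.str.p) n
  have := isTorsionFree_fiberPower (q := T.str.p) n
  have : Module.Free R (fiberPower T.str.p n : CommAlgCat.{u} R) :=
    Module.free_of_finite_type_torsion_free'
  exact CommAlgCat.isRightAdjoint_tensorLeft _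

end Classification

end TangentoidTheory

end
theorem mainTheorem3 {R : Type u} [CommRing R] [IsDomain R] [IsPrincipalIdealRing R] :
    ∃ (t₀ : TangentoidTheory.TangentoidStr (𝟙_ (CommAlgCat.{u} R)))
      (t₁ : TangentoidTheory.TangentoidStr (CommAlgCat.of R R[ε])),
      TangentoidTheory.IsTrivialStr t₀ ∧ TangentoidTheory.IsDualNumberStr t₁ ∧
      (TangentoidTheory.Tangentoid.mk _ t₀).IsCoexponentiable ∧
      (TangentoidTheory.Tangentoid.mk _ t₁).IsCoexponentiable ∧
      IsEmpty (𝟙_ (CommAlgCat.{u} R) ≅ CommAlgCat.of R R[ε]) ∧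
      ∀ T : TangentoidTheory.Tangentoid (CommAlgCat.{u} R), T.IsCoexponentiable →
        Nonempty (T ≅ TangentoidTheory.Tangentoid.mk _ t₀) ∨
          Nonempty (T ≅ TangentoidTheory.Tangentoid.mk _ t₁) := by
  have : Module.Finite R (𝟙_ (CommAlgCat.{u} R) : CommAlgCat.{u} R) :=
    inferInstanceAs (Module.Finite R R)
  have : Module.Free R (𝟙_ (CommAlgCat.{u} R) : CommAlgCat.{u} R) :=
    inferInstanceAs (Module.Free R R)
  have : Module.Finite R (CommAlgCat.of R R[ε]) := inferInstanceAs (Module.Finite R (R × R))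
  have : Module.Free R (CommAlgCat.of R R[ε]) := inferInstanceAs (Module.Free R (R × R))
  have := CommAlgCat.isRightAdjoint_tensorLeft (𝟙_ (CommAlgCat.{u} R))
  have := TangentoidTheory.tensorPreservesFiberPowers_of_isRightAdjoint
    (𝟙_ (CommAlgCat.{u} R)) (𝟙 (𝟙_ (CommAlgCat.{u} R)))
  refine ⟨TangentoidTheory.trivialStr _, TangentoidTheory.dualStr R, ⟨rfl, rfl, rfl, rfl, rfl⟩,
    TangentoidTheory.isDualNumberStr_dualStr R,
    TangentoidTheory.isCoexponentiable_of_finite _,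
    TangentoidTheory.isCoexponentiable_of_finite _, ⟨fun i => ?_⟩,
    TangentoidTheory.Tangentoid.nonempty_iso_or_nonempty_iso⟩
  -- An isomorphism would make `ε` the image of a scalar, contradicting that its second coordinate
  -- is `1 ≠ 0`.
  let f : R →ₐ[R] R[ε] := i.hom.hom
  obtain ⟨r, hr⟩ : ∃ r : R, f r = (ε : R[ε]) :=
    ⟨i.inv.hom (ε : R[ε]), CommAlgCat.hom_inv_apply i _⟩
  have h : f r = algebraMap R R[ε] r := f.commutes r
  rw [h, TrivSqZeroExt.algebraMap_eq_inl] at hr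
  simpa using congrArg TrivSqZeroExt.snd hr
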